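/- **Theorem 2.9.** Let $k\ge 2$ and $n\ge k+2$. Write $[n]=\{1,\dots,n\}$, with indices read modulo $n$ where cyclic neighbours are meant, and call $J\in\binom{[n]}{k}$ *non-cyclic* if it is not a cyclic interval $\{a,a+1,\dots,a+m-1\}\pmod n$. *Positive parametrization.* Let $x_{\ell,t}$ ($1\le \ell\le k-1$, $1\le t\le n-k$) be variables, and let $M(x)$ be the $k\times n$ matrix whose first $k$ columns form the identity matrix and whose entry in row $i$ and column $k+j$ is $$m_{i,j}=(-1)^{k-i}\sum_{1\le b_i\le b_{i+1}\le\cdots\le b_{k-1}\le j}x_{i,b_i}x_{i+1,b_{i+1}}\cdots x_{k-1,b_{k-1}}\qquad(1\le i\le k,\ 1\le j\le n-k),$$ so that $m_{k,j}=1$. For $I\in\binom{[n]}{k}$ let $p_I(x)$ be the maximal minor of $M(x)$ in the columns $I$ (in increasing order), and let $p_I^t(y)$, $y\in(\mathbb R^{n-k})^{k-1}$, be its tropicalization under $(+,\times)\mapsto(\min,+)$, i.e. the minimum of $\sum d_{\ell,t}\,y_{\ell,t}$ over the monomials $\prod x_{\ell,t}^{d_{\ell,t}}$ that occur in $p_I(x)$.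 *Planar cross-ratios.* For $J\in\binom{[n]}{k}$ put $I_J=\{j\in J: j+1\notin J\}$, and let $C_J$ be the set of $k$-subsets $(J\setminus S)\cup\{s+1: s\in S\}$ with $S\subseteq I_J$. The planar cross-ratio is $u_J=\prod_{K\in C_J}p_K^{(-1)^{|J\cap K|-k-1}}$, and its tropicalization, pulled back along the positive parametrization, is $$u_J^t(y)=\sum_{K\in C_J}(-1)^{|J\cap K|-k-1}\,p_K^t(y).$$ *Rays of the noncrossing fan.* Let $\mathbb T^{k,n}=\bigl(\mathbb R^{n-k}/\mathbb R(1,\dots,1)\bigr)^{k-1}$, and let $e_{i,s}$ ($1\le i\le k-1$, $1\le s\le n-k$) be the images in it of the standard basis vectors of $(\mathbb R^{n-k})^{k-1}$. For $J=\{j_1<\cdots<j_k\}$ put $$\mathfrak t_J=\sum_{i=1}^{k-1}\ \sum_{s=j_i-(i-1)}^{j_{i+1}-(i+1)}e_{i,s}\in\mathbb T^{k,n}.$$ *Claim.* For every non-cyclic $J\in\binom{[n]}{k}$ the function $u_J^t$ descends to a well-defined function on $\mathbb T^{k,n}$, and for all non-cyclic $J,J'\in\binom{[n]}{k}$, $$u_J^t(\mathfrak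 t_{J'})=\delta_{J,J'}.$$ -/

import Mathlib

/-! Conventions: the ground set `[n] = {1, …, n}`, the rows `[k]`, the levels `[k-1]` and the
positions `[n-k]` are modelled by `Fin n`, `Fin k`, `Fin (k-1)` and `Fin (n-k)`, that is, every
index is shifted down by one. -/

namespace PlanarCrossRatio

/-- The set of `k`-element subsets of `[n]`. -/
abbrev KSubset (k n : ℕ) : Type := {J : Finset (Fin n) // J.card = k}

/-- The cyclic successor `j ↦ j + 1 (mod n)` on `[n]`. -/
def next {n : ℕ} (j : Fin n) : Fin n :=
  ⟨((j : ℕ) + 1) % n, Nat.mod_lt _ (Nat.lt_of_le_of_lt (Nat.zero_le _) j.isLt)⟩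

/-- `J` is a cyclic interval `{a, a+1, …, a+m-1} (mod n)`. -/
def IsCyclicInterval {n : ℕ} (J : Finset (Fin n)) : Prop :=
  ∃ (a : Fin n) (m : ℕ), J = (Finset.range m).image (fun i => next^[i] a)

/-! ### The positive parametrization -/

/-- The variables `x_{ℓ,t}`, `ℓ ∈ [k-1]`, `t ∈ [n-k]`. -/
abbrev Var (k n : ℕ) : Type := Fin (k - 1) × Fin (n - k)

/-- The entry in row `i` and position `j` of the right-hand `k × (n-k)` block:
`(-1)^{k-i} ∑ x_{i,b_i} x_{i+1,b_{i+1}} ⋯ x_{k-1,b_{k-1}}` (one-based `i`), the sum being over all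
weakly increasing sequences `b_i ≤ b_{i+1} ≤ ⋯ ≤ b_{k-1} ≤ j`.  For the last row the sequence is
empty, so that all entries there are `1`. -/
noncomputable def ladderEntry (k n : ℕ) (i : Fin k) (j : Fin (n - k)) :
    MvPolynomial (Var k n) ℝ :=
  (-1) ^ (k - 1 - (i : ℕ)) *
    ∑ b : {ℓ : Fin (k - 1) // (i : ℕ) ≤ (ℓ : ℕ)} → Fin (n - k) with
        (∀ ℓ ℓ', ℓ ≤ ℓ' → b ℓ ≤ b ℓ') ∧ ∀ ℓ, b ℓ ≤ j,
      ∏ ℓ, MvPolynomial.X (ℓ.1, b ℓ)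

/-- The `k × n` matrix `M(x)` of the positive parametrization: the identity matrix in the first
`k` columns, followed by the block of the `ladderEntry`s. -/
noncomputable def paramMatrix (k n : ℕ) :
    Matrix (Fin k) (Fin n) (MvPolynomial (Var k n) ℝ) :=
  fun i c =>
    if h : (c : ℕ) < k then (if (i : ℕ) = (c : ℕ) then 1 else 0)
    else ladderEntry k n i ⟨(c : ℕ) - k, Nat.sub_lt_sub_right (Nat.le_of_not_lt h) c.isLt⟩

/-- The Plücker coordinate `p_I(x)`: the maximal minor of `M(x)` in the columns `I`, taken in
increasing order. -/
noncomputable def pluckerPoly {k n : ℕ} (I : KSubset k n) : MvPolynomial (Var k n) ℝ :=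
  ((paramMatrix k n).submatrix id (I.1.orderEmbOfFin I.2)).det

/-! ### Tropicalization -/

/-- The tropicalization `f^t` of a nonzero polynomial `f` at `y`, under
`(+, ×) ↦ (min, +)`: the minimum over the monomials `x^d` of `f` of `∑ d_v y_v`.
(The value for `f = 0` is irrelevant.) -/
noncomputable def tropPoly {σ : Type*} (f : MvPolynomial σ ℝ) (y : σ → ℝ) : ℝ :=
  if h : f.support.Nonempty then f.support.inf' h (fun d => d.sum fun v m => (m : ℝ) * y v)
  else 0

/-- The tropical positive parametrization on representatives: the vector of the tropicalized
Plücker coordinates `p_I^t(y)`. -/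
noncomputable def tropParam {k n : ℕ} (y : Fin (k - 1) → Fin (n - k) → ℝ) : KSubset k n → ℝ :=
  fun I => tropPoly (pluckerPoly I) (fun v => y v.1 v.2)

/-! ### Planar cross-ratios -/

/-- The cyclic endpoints `I_J = {j ∈ J : j + 1 ∉ J}`. -/
def cyclicEndpoints {n : ℕ} (J : Finset (Fin n)) : Finset (Fin n) :=
  {j ∈ J | next j ∉ J}

/-- The cubical array `C_J`: the `k`-subsets `e_J + ∑_{m ∈ M} (-e_m + e_{m+1})`, obtained from
`J` by moving the elements of some `M ⊆ I_J` one step to the right. -/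
def cubicalArray {k n : ℕ} (J : KSubset k n) : Finset (KSubset k n) :=
  {K | ∃ M ∈ (cyclicEndpoints J.1).powerset, K.1 = (J.1 \ M) ∪ M.image next}

/-- The tropicalization of the planar cross-ratio
`u_J = ∏_{K ∈ C_J} p_K ^ ((-1)^{|J ∩ K| - k - 1})`, a linear function of the tropical Plücker
vector `π`. -/
noncomputable def tropCrossRatio {k n : ℕ} (J : KSubset k n) (π : KSubset k n → ℝ) : ℝ :=
  ∑ K ∈ cubicalArray J, (-1 : ℝ) ^ (((J.1 ∩ K.1).card : ℤ) - (k : ℤ) - 1) * π K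

/-! ### The space `𝕋^{k,n}` and the rays of the noncrossing fan -/

/-- The quotient `ℝ^N / ℝ(1, …, 1)`. -/
abbrev TropTorus (N : ℕ) : Type := (Fin N → ℝ) ⧸ Submodule.span ℝ {(fun _ => 1 : Fin N → ℝ)}

/-- `𝕋^{k,n} = (ℝ^{n-k} / ℝ(1, …, 1))^{k-1}`. -/
abbrev TropSpace (k n : ℕ) : Type := Fin (k - 1) → TropTorus (n - k)

/-- The quotient map `(ℝ^{n-k})^{k-1} → 𝕋^{k,n}`. -/
def toTropSpace {k n : ℕ} (y : Fin (k - 1) → Fin (n - k) → ℝ) : TropSpace k n :=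
  fun ℓ => Submodule.Quotient.mk (y ℓ)

/-- The element `j_{i+1}` (zero-based `i`) of `J = {j_1 < ⋯ < j_k}`, as an element of `Fin n`. -/
def elt {k n : ℕ} (J : KSubset k n) (i : Fin k) : Fin n := J.1.orderEmbOfFin J.2 i

/-- The vector `𝔱_J = ∑_{i=1}^{k-1} ∑_{s = j_i-(i-1)}^{j_{i+1}-(i+1)} e_{i,s} ∈ 𝕋^{k,n}`.
For the zero-based indices `i`, `s` and the zero-based elements `j` of `J` the range of `s` reads
`j_i - i ≤ s ≤ j_{i+1} - i - 2`. -/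
def rayVector {k n : ℕ} (J : KSubset k n) : TropSpace k n :=
  toTropSpace fun i s =>
    if (elt J ⟨(i : ℕ), by omega⟩ : ℕ) ≤ (s : ℕ) + (i : ℕ) ∧
        (s : ℕ) + (i : ℕ) + 2 ≤ (elt J ⟨(i : ℕ) + 1, by omega⟩ : ℕ)
    then 1 else 0

end PlanarCrossRatio

/-! Index the variable `x_{i,s}` by its level and column, as `(i + 1, s + i + 1)`. Subtracting
neighbouring columns of `M(x)` and expanding along the last row expresses a maximal minor with
`l + 1` rows through those with `l` rows (`minor_succ`): the column set `I` is replaced by all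
sets `r` interlacing it, and `r` contributes the product of the variables `x_{l, r_a}` at its
columns `r_a ≥ l`. The signs cancel, so all coefficients are nonnegative, nothing cancels in the sum, and
the monomials of `p_I` are exactly the products of these contributions along chains of interlacing
sets (`mem_support_minor_succ`).

Two facts about `p_I^t` follow by induction on the number of rows. If every level of `y` is
translated by a constant, then `p_I^t(y)` changes by a linear combination of the counts
`#(I ∩ [m])` and a constant (`expWeight_of_rowConstant`). At the ray of `J'`, up to an additive
constant,
`p_I^t(𝔱_{J'}) = max_s (#(J' ∩ [s]) - #(I ∩ [s])) + #(I ∩ [j'_k])`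
(`le_expWeight_rayWeight`, `exists_expWeight_rayWeight_le`, `tropParam_rayRep`).

The tropical cross-ratio `u_J^t` is an alternating sum over the subsets `M` of the cyclic endpoints
`I_J`. If `J` is non-cyclic, then `I_J` has at least two elements, so every function that is a sum
over the elements of `M` has alternating sum zero. This disposes of the counts `#(I ∩ [m])`, hence
`u_J^t` descends to the quotient. Moving the elements of `M` to the right changes
`h(c) = #(J' ∩ [c]) - #(J ∩ [c])` by the indicator of `c ∈ M`, up to a summand independent of `c`
and additive in `M`, so that the maximum becomes `max h` or `max h + 1` according to whether `M`
misses or meets the set `T` of maximizers of `h`. The alternating sum then is `1` if `I_J ⊆ T` and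
`0` otherwise (`altSum_hits`). Finally `I_J ⊆ T` forces `h` to be constant, that is, `J = J'`
(`eq_of_cyclicEndpoints_maximal`). -/

namespace PlanarCrossRatio

/-! ### The column recursion for maximal minors -/

/-- The column `c` (zero-based) of the parametrizing matrix with `l` rows, built one row at a time.
The variable at level `m` and column `t` is `X (m, t)` with `m ≤ t`; it enters when row `m` is added
to the matrix with `m` rows. -/
noncomputable def column : (l : ℕ) → ℕ → Fin l → MvPolynomial (ℕ × ℕ) ℝ
  | 0, _ => Fin.elim0
  | l + 1, c => Fin.snoc (α := fun _ => MvPolynomial (ℕ × ℕ) ℝ)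
      (fun r => if c < l then column l c r else
        -∑ t ∈ Finset.Ico l c, MvPolynomial.X (l, t) * column l t r)
      (if c < l then 0 else 1)

/-- The maximal minor of the parametrizing matrix with `l` rows in the columns `I 0, I 1, …`; the
matrix is transposed, so that these columns are its rows. -/
noncomputable def minor (l : ℕ) (I : Fin l → ℕ) : MvPolynomial (ℕ × ℕ) ℝ :=
  (Matrix.of fun a r => column l (I a) r).det

/-- The positions allowed to the `a`-th element of a set interlacing `I`: the elements of `I` below
`l` stay fixed, the others may move to the right until just before the next element of `I`. -/
def steps {l : ℕ} (I : Fin (l + 1) → ℕ) (a : Fin l) : Finset ℕ :=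
  if I a.castSucc < l then {I a.castSucc} else Finset.Ico (I a.castSucc) (I a.succ)

theorem column_succ_castSucc (l c : ℕ) (r : Fin l) :
    column (l + 1) c r.castSucc = if c < l then column l c r
      else -∑ t ∈ Finset.Ico l c, MvPolynomial.X (l, t) * column l t r := by
  simp [column]

theorem column_succ_last (l c : ℕ) :
    column (l + 1) c (Fin.last l) = if c < l then 0 else 1 := by
  simp [column]

theorem strictMono_le_apply {l : ℕ} {I : Fin l → ℕ} (hI : StrictMono I) (a : Fin l) :
    (a : ℕ) ≤ I a := by
  obtain ⟨a, ha⟩ := a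
  induction a with
  | zero => simp
  | succ a ih =>
    have h1 := ih (by omega)
    have h2 : I ⟨a, by omega⟩ < I ⟨a + 1, ha⟩ := hI (by simp)
    simp only at h1 ⊢
    omega

/-- A set of `l + 1` columns contains one outside `{0, …, l - 1}`, so the elements of `I` below `l`
are those at positions before some `p ≤ l`. -/
theorem exists_threshold {l : ℕ} {I : Fin (l + 1) → ℕ} (hI : StrictMono I) :
    ∃ p : Fin (l + 1), ∀ b, I b < l ↔ b < p := by
  have hne : (Finset.univ.filter fun a => l ≤ I a).Nonempty :=
    ⟨Fin.last l, by simpa using strictMono_le_apply hI (Fin.last l)⟩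
  refine ⟨Finset.min' _ hne, fun b => ?_⟩
  have hmem := Finset.min'_mem _ hne
  set p := Finset.min' _ hne
  simp only [Finset.mem_filter, Finset.mem_univ, true_and] at hmem
  constructor
  · intro hb
    exact hI.lt_iff_lt.1 (hb.trans_le hmem)
  · intro hb
    by_contra hcon
    exact absurd hb (not_lt.2 (Finset.min'_le _ _ (by simpa using hcon)))

theorem prod_threshold_sign {R : Type*} [CommRing R] {l : ℕ} (p : Fin (l + 1)) :
    (∏ b : Fin l, if b.castSucc < p then (1 : R) else -1) = (-1) ^ ((p : ℕ) + l) := by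
  have h1 : (∏ b : Fin l, if b.castSucc < p then (-1 : R) else 1) = (-1) ^ (p : ℕ) := by
    rw [Finset.prod_ite, Finset.prod_const, Finset.prod_const_one, mul_one]
    congr 1
    have : (p : ℕ) ≤ l := by omega
    rw [show (Finset.univ.filter fun b : Fin l => b.castSucc < p)
        = Finset.univ.filter fun b : Fin l => (b : ℕ) < p from by
      ext b; simp [Fin.lt_def]]
    simp [Fin.card_filter_val_lt, this]
  have h2 : (∏ b : Fin l, if b.castSucc < p then (1 : R) else -1)
      * (∏ b : Fin l, if b.castSucc < p then (-1 : R) else 1) = (-1) ^ l := by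
    rw [← Finset.prod_mul_distrib]
    rw [Finset.prod_congr rfl (g := fun _ => (-1 : R))]
    · simp
    · intro b _
      split_ifs <;> simp
  rw [h1] at h2
  rw [pow_add, ← h2, mul_comm, mul_assoc, ← mul_pow]
  simp

/-- Subtract from each column the preceding one of `I` if that is not among the first `l` (identity)
columns. The last row then has a single nonzero entry, at the first column that is at least `l`, and
after expanding there the differences are sums of columns of the matrix with `l` rows, so that
multilinearity applies. The signs of these sums cancel against the sign of the expansion. -/
theorem minor_succ {l : ℕ} {I : Fin (l + 1) → ℕ} (hI : StrictMono I) :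
    minor (l + 1) I = ∑ r ∈ Fintype.piFinset (steps I),
      (∏ a, if I a.castSucc < l then 1 else MvPolynomial.X (l, r a)) * minor l r := by
  obtain ⟨p, hp⟩ := exists_threshold hI
  set B : Matrix (Fin (l + 1)) (Fin (l + 1)) (MvPolynomial (ℕ × ℕ) ℝ) :=
    Matrix.of (Fin.cons (fun r => column (l + 1) (I 0) r) fun a r =>
      column (l + 1) (I a.succ) r
        - (if I a.castSucc < l then 0 else 1) * column (l + 1) (I a.castSucc) r) with hB
  have hdet : minor (l + 1) I = B.det := by
    refine Matrix.det_eq_of_forall_row_eq_smul_add_pred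
      (fun a => if I a.castSucc < l then 0 else 1) ?_ ?_
    · intro j; simp [hB]
    · intro a j; simp [hB]
  -- The last entries of consecutive columns of `I` are `0, …, 0, 1, …, 1`.
  have hlast : ∀ a, B a (Fin.last l) = if a = p then 1 else 0 := by
    intro a
    induction a using Fin.cases with
    | zero =>
      simp only [hB, Matrix.of_apply, Fin.cons_zero, column_succ_last, hp]
      rcases Fin.eq_zero_or_eq_succ p with h | ⟨q, rfl⟩
      · simp [h]
      · simp [Fin.ext_iff]
    | succ a =>
      simp only [hB, Matrix.of_apply, Fin.cons_succ, column_succ_last, hp]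
      have e1 : a.succ < p ↔ (a : ℕ) + 1 < p := by simp [Fin.lt_def]
      have e2 : a.castSucc < p ↔ (a : ℕ) < p := by simp [Fin.lt_def]
      have e3 : a.succ = p ↔ (a : ℕ) + 1 = p := by simp [Fin.ext_iff]
      simp only [e1, e2, e3]
      split_ifs <;> first | omega | simp
  -- `w b t` is the coefficient of the column `t` in the `b`-th column that remains.
  set w : Fin l → ℕ → MvPolynomial (ℕ × ℕ) ℝ := fun b t =>
    if I b.castSucc < l then 1 else -MvPolynomial.X (l, t) with hw
  have hsub : B.submatrix p.succAbove (Fin.last l).succAbove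
      = fun b => ∑ t ∈ steps I b, w b t • column l t := by
    funext b r
    rw [Matrix.submatrix_apply, Fin.succAbove_last, Finset.sum_apply]
    by_cases hb : I b.castSucc < l
    · have hbp := (hp _).1 hb
      rw [Fin.succAbove_of_castSucc_lt _ _ hbp]
      simp only [steps, hw, if_pos hb, Finset.sum_singleton, one_smul]
      generalize hx : b.castSucc = x at *
      have hx' : B x r.castSucc = column (l + 1) (I x) r.castSucc := by
        induction x using Fin.cases with
        | zero => simp [hB]
        | succ a =>
          have : I a.castSucc < l := lt_trans (hI (by simp [Fin.lt_def])) hb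
          simp [hB, this]
      rw [hx', column_succ_castSucc, if_pos hb]
    · have hbp : p ≤ b.castSucc := not_lt.1 fun h => hb ((hp _).2 h)
      rw [Fin.succAbove_of_le_castSucc _ _ hbp]
      have hlt : I b.castSucc < I b.succ := hI (by simp [Fin.lt_def])
      have hb2 : ¬ I b.succ < l := by omega
      simp only [steps, hw, if_neg hb, hB, Matrix.of_apply, Fin.cons_succ,
        column_succ_castSucc, if_neg hb2, Pi.smul_apply, smul_eq_mul, neg_mul, one_mul,
        Finset.sum_neg_distrib]
      rw [← Finset.sum_Ico_consecutive _ (not_lt.1 hb) hlt.le]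
      ring
  rw [hdet, Matrix.det_succ_column B (Fin.last l), Finset.sum_eq_single p, hlast, if_pos rfl, hsub]
  · have key : Matrix.det (fun b => ∑ t ∈ steps I b, w b t • column l t)
        = ∑ r ∈ Fintype.piFinset (steps I), (∏ b, w b (r b)) * minor l r := by
      have h := (Matrix.detRowAlternating (n := Fin l)
        (R := MvPolynomial (ℕ × ℕ) ℝ)).toMultilinearMap.map_sum_finset
        (fun b t => w b t • column l t) (steps I)
      refine h.trans (Finset.sum_congr rfl fun r _ => ?_)
      exact (Matrix.detRowAlternating (n := Fin l)
        (R := MvPolynomial (ℕ × ℕ) ℝ)).toMultilinearMap.map_smul_univ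
        (fun b => w b (r b)) (fun b => column l (r b))
    rw [key, Finset.mul_sum]
    refine Finset.sum_congr rfl fun r _ => ?_
    have hwr : ∏ b, w b (r b) = (-1) ^ ((p : ℕ) + l)
        * ∏ a, if I a.castSucc < l then 1 else MvPolynomial.X (l, r a) := by
      rw [← prod_threshold_sign, ← Finset.prod_mul_distrib]
      refine Finset.prod_congr rfl fun b _ => ?_
      simp only [hw, ← hp]
      split_ifs <;> simp
    rw [hwr, Fin.val_last, mul_one, ← mul_assoc, ← mul_assoc, ← mul_pow]
    simp
  · intro b _ hb
    simp [hlast, hb]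
  · simp

/-! ### Monomials of the minors -/

/-- `r` interlaces `I`: each `r a` lies in `[I a, I (a + 1))`, and elements of `I` below `l` stay
fixed. -/
def IsInterlacing {l : ℕ} (I : Fin (l + 1) → ℕ) (r : Fin l → ℕ) : Prop :=
  ∀ a, I a.castSucc ≤ r a ∧ r a < I a.succ ∧ (I a.castSucc < l → r a = I a.castSucc)

theorem mem_piFinset_steps {l : ℕ} {I : Fin (l + 1) → ℕ} (hI : StrictMono I) {r : Fin l → ℕ} :
    r ∈ Fintype.piFinset (steps I) ↔ IsInterlacing I r := by
  rw [Fintype.mem_piFinset]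
  refine forall_congr' fun a => ?_
  have h : I a.castSucc < I a.succ := hI (by simp [Fin.lt_def])
  unfold steps
  split_ifs with h1
  · simp only [Finset.mem_singleton]; omega
  · simp only [Finset.mem_Ico]; omega

theorem IsInterlacing.strictMono {l : ℕ} {I : Fin (l + 1) → ℕ} {r : Fin l → ℕ}
    (h : IsInterlacing I r) (hI : StrictMono I) : StrictMono r := by
  intro a b hab
  have h1 : I a.succ ≤ I b.castSucc :=
    hI.monotone (by rw [Fin.le_def]; simpa using hab)
  have h2 := (h a).2.1
  have h3 := (h b).1
  omega

theorem isInterlacing_castSucc {l : ℕ} {I : Fin (l + 1) → ℕ} (hI : StrictMono I) :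
    IsInterlacing I fun a => I a.castSucc :=
  fun a => ⟨le_rfl, hI (by simp [Fin.lt_def]), fun _ => rfl⟩

/-- The exponent of the monomial with which `r` contributes to `minor (l + 1) I`. -/
noncomputable def stepExponent {l : ℕ} (I : Fin (l + 1) → ℕ) (r : Fin l → ℕ) : (ℕ × ℕ) →₀ ℕ :=
  ∑ a, if I a.castSucc < l then 0 else Finsupp.single (l, r a) 1

theorem minor_zero (I : Fin 0 → ℕ) : minor 0 I = 1 := by simp [minor]

theorem minor_succ_eq_sum_monomial {l : ℕ} {I : Fin (l + 1) → ℕ} (hI : StrictMono I) :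
    minor (l + 1) I = ∑ r ∈ Fintype.piFinset (steps I),
      MvPolynomial.monomial (stepExponent I r) 1 * minor l r := by
  rw [minor_succ hI]
  refine Finset.sum_congr rfl fun r _ => ?_
  congr 1
  rw [stepExponent, MvPolynomial.monomial_sum_one]
  refine Finset.prod_congr rfl fun a _ => ?_
  split_ifs
  · rfl
  · rfl

theorem coeff_minor_nonneg {l : ℕ} {I : Fin l → ℕ} (hI : StrictMono I) (d : (ℕ × ℕ) →₀ ℕ) :
    0 ≤ (minor l I).coeff d := by
  classical
  induction l generalizing d with
  | zero =>
    rw [minor_zero, MvPolynomial.coeff_one]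
    split_ifs <;> simp
  | succ l ih =>
    rw [minor_succ_eq_sum_monomial hI, MvPolynomial.coeff_sum]
    refine Finset.sum_nonneg fun r hr => ?_
    rw [MvPolynomial.coeff_monomial_mul']
    split_ifs
    · rw [one_mul]
      exact ih (((mem_piFinset_steps hI).1 hr).strictMono hI) _
    · exact le_rfl

/-- As all coefficients are nonnegative, no monomial of the recursion is cancelled. -/
theorem mem_support_minor_succ {l : ℕ} {I : Fin (l + 1) → ℕ} (hI : StrictMono I)
    {d : (ℕ × ℕ) →₀ ℕ} :
    d ∈ (minor (l + 1) I).support ↔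
      ∃ r, IsInterlacing I r ∧ ∃ e ∈ (minor l r).support, d = stepExponent I r + e := by
  classical
  have hnn : ∀ r ∈ Fintype.piFinset (steps I),
      0 ≤ (MvPolynomial.monomial (stepExponent I r) 1 * minor l r).coeff d := by
    intro r hr
    rw [MvPolynomial.coeff_monomial_mul']
    split_ifs
    · rw [one_mul]
      exact coeff_minor_nonneg (((mem_piFinset_steps hI).1 hr).strictMono hI) _
    · exact le_rfl
  rw [MvPolynomial.mem_support_iff, minor_succ_eq_sum_monomial hI, MvPolynomial.coeff_sum, Ne,
    Finset.sum_eq_zero_iff_of_nonneg hnn]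
  push Not
  refine exists_congr fun r => ?_
  rw [mem_piFinset_steps hI]
  refine and_congr_right fun _ => ?_
  rw [MvPolynomial.coeff_monomial_mul']
  constructor
  · intro h
    split_ifs at h with hle
    · exact ⟨d - stepExponent I r, by simpa [MvPolynomial.mem_support_iff] using h,
        (add_tsub_cancel_of_le hle).symm⟩
    · exact absurd rfl h
  · rintro ⟨e, he, rfl⟩
    rw [if_pos le_self_add, add_tsub_cancel_left, one_mul]
    exact MvPolynomial.mem_support_iff.1 he

theorem mem_support_minor_zero {I : Fin 0 → ℕ} {d : (ℕ × ℕ) →₀ ℕ} :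
    d ∈ (minor 0 I).support ↔ d = 0 := by
  classical
  rw [minor_zero, MvPolynomial.mem_support_iff, MvPolynomial.coeff_one]
  simp [eq_comm]

/-- The weight `∑ d_v y_v` of the monomial `x^d`. The coefficients are in any semiring, so that
weights of rays can be computed in `ℕ`. -/
def expWeight {σ R : Type*} [CommSemiring R] (y : σ → R) (d : σ →₀ ℕ) : R :=
  d.sum fun v m => (m : R) * y v

section
variable {σ R : Type*} [CommSemiring R] (y : σ → R)

theorem expWeight_zero : expWeight y 0 = 0 := by simp [expWeight]

theorem expWeight_add (d e : σ →₀ ℕ) : expWeight y (d + e) = expWeight y d + expWeight y e := by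
  classical
  unfold expWeight
  rw [Finsupp.sum_add_index'] <;> intros <;> simp [add_mul]

theorem expWeight_single (v : σ) : expWeight y (Finsupp.single v 1) = y v := by
  simp [expWeight]

theorem expWeight_sum {ι : Type*} (s : Finset ι) (d : ι → σ →₀ ℕ) :
    expWeight y (∑ i ∈ s, d i) = ∑ i ∈ s, expWeight y (d i) := by
  classical
  induction s using Finset.induction_on with
  | empty => simp [expWeight_zero]
  | insert a s ha ih => rw [Finset.sum_insert ha, Finset.sum_insert ha, expWeight_add, ih]

end

theorem expWeight_stepExponent {R : Type*} [CommSemiring R] (y : ℕ × ℕ → R) {l : ℕ}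
    (I : Fin (l + 1) → ℕ) (r : Fin l → ℕ) :
    expWeight y (stepExponent I r) = ∑ a, if I a.castSucc < l then 0 else y (l, r a) := by
  rw [stepExponent, expWeight_sum]
  refine Finset.sum_congr rfl fun a _ => ?_
  split_ifs
  · exact expWeight_zero y
  · exact expWeight_single y _

/-! ### Counting elements below a bound -/

/-- The number of terms of `I` that are smaller than `s`. -/
def countBelow {l : ℕ} (I : Fin l → ℕ) (s : ℕ) : ℕ := (Finset.univ.filter fun a => I a < s).card

section
variable {l : ℕ}

theorem countBelow_le (I : Fin l → ℕ) (s : ℕ) : countBelow I s ≤ l :=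
  (Finset.card_filter_le _ _).trans (by simp)

theorem countBelow_mono (I : Fin l → ℕ) : Monotone (countBelow I) := fun s t hst =>
  Finset.card_le_card fun a => by simp only [Finset.mem_filter, Finset.mem_univ, true_and]; omega

theorem countBelow_eq_sum (I : Fin l → ℕ) (s : ℕ) :
    countBelow I s = ∑ a, if I a < s then 1 else 0 := by
  rw [countBelow, Finset.card_filter]

theorem countBelow_eq_castSucc_add (I : Fin (l + 1) → ℕ) (s : ℕ) :
    countBelow I s
      = countBelow (fun a => I a.castSucc) s + if I (Fin.last l) < s then 1 else 0 := by
  rw [countBelow_eq_sum, countBelow_eq_sum, Fin.sum_univ_castSucc]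

theorem countBelow_eq_add_succ (I : Fin (l + 1) → ℕ) (s : ℕ) :
    countBelow I s = (if I 0 < s then 1 else 0) + countBelow (fun a => I a.succ) s := by
  rw [countBelow_eq_sum, countBelow_eq_sum, Fin.sum_univ_succ]

theorem lt_countBelow_iff {I : Fin l → ℕ} (hI : StrictMono I) (a : Fin l) (s : ℕ) :
    (a : ℕ) < countBelow I s ↔ I a < s := by
  constructor
  · intro h
    by_contra hc
    have : countBelow I s ≤ (Finset.Iio a).card := Finset.card_le_card fun b hb => by
      simp only [Finset.mem_filter, Finset.mem_univ, true_and] at hb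
      rw [Finset.mem_Iio]
      exact hI.lt_iff_lt.1 (by omega)
    rw [Fin.card_Iio] at this
    omega
  · intro h
    have : (Finset.Iic a).card ≤ countBelow I s := Finset.card_le_card fun b hb => by
      rw [Finset.mem_Iic] at hb
      have := hI.monotone hb
      simp only [Finset.mem_filter, Finset.mem_univ, true_and]
      omega
    rw [Fin.card_Iic] at this
    omega

theorem countBelow_le_add {I : Fin l → ℕ} (hI : StrictMono I) (s t : ℕ) :
    countBelow I t ≤ countBelow I s + (t - s) := by
  unfold countBelow
  calc (Finset.univ.filter fun a => I a < t).card
      ≤ ((Finset.univ.filter fun a => I a < s)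
          ∪ (Finset.univ.filter fun a => s ≤ I a ∧ I a < t)).card :=
        Finset.card_le_card fun a => by
          simp only [Finset.mem_filter, Finset.mem_univ, true_and, Finset.mem_union]; omega
    _ ≤ _ := Finset.card_union_le _ _
    _ ≤ _ := by
      refine Nat.add_le_add_left ?_ _
      rw [← Nat.card_Ico, ← Finset.card_image_of_injective _ hI.injective]
      refine Finset.card_le_card fun b hb => ?_
      simp only [Finset.mem_image, Finset.mem_filter, Finset.mem_univ, true_and] at hb
      obtain ⟨a, ha, rfl⟩ := hb
      exact Finset.mem_Ico.2 ha

theorem countBelow_eq_of_forall {I : Fin l → ℕ} {s m : ℕ} (hm : m ≤ l)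
    (h : ∀ a : Fin l, I a < s ↔ (a : ℕ) < m) : countBelow I s = m := by
  unfold countBelow
  simp only [h]
  simp [Fin.card_filter_val_lt, hm]

theorem countBelow_zero (I : Fin l → ℕ) : countBelow I 0 = 0 := by simp [countBelow]

theorem IsInterlacing.countBelow_le {I : Fin (l + 1) → ℕ} {r : Fin l → ℕ}
    (h : IsInterlacing I r) (s : ℕ) : countBelow r s ≤ countBelow I s := by
  rw [countBelow_eq_castSucc_add I]
  refine le_add_right (Finset.card_le_card fun a => ?_)
  have := (h a).1
  simp only [Finset.mem_filter, Finset.mem_univ, true_and]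
  omega

theorem IsInterlacing.countBelow_succ_le {I : Fin (l + 1) → ℕ} {r : Fin l → ℕ}
    (h : IsInterlacing I r) (s : ℕ) : countBelow I (s + 1) ≤ countBelow r s + 1 := by
  rw [countBelow_eq_add_succ I]
  have : countBelow (fun a => I a.succ) (s + 1) ≤ countBelow r s :=
    Finset.card_le_card fun a => by
      have := (h a).2.1
      simp only [Finset.mem_filter, Finset.mem_univ, true_and]
      omega
  split_ifs <;> omega

theorem IsInterlacing.countBelow_eq {I : Fin (l + 1) → ℕ} {r : Fin l → ℕ}
    (h : IsInterlacing I r) (hI : StrictMono I) {s : ℕ} (hs : s ≤ l) :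
    countBelow r s = countBelow I s := by
  have h1 := strictMono_le_apply hI (Fin.last l)
  rw [Fin.val_last] at h1
  rw [countBelow_eq_castSucc_add I, if_neg (by omega), add_zero]
  unfold countBelow
  congr 1
  refine Finset.filter_congr fun a _ => ?_
  have := h a
  dsimp only
  omega

end

/-! ### Homogeneity in the variables of each level -/

/-- `minor l I` is homogeneous in the variables of each level `m`, of degree the number of columns
among the first `m` that are missing from `I`. -/
theorem expWeight_of_rowConstant (c : ℕ → ℝ) {l : ℕ} {I : Fin l → ℕ} (hI : StrictMono I)
    {d : (ℕ × ℕ) →₀ ℕ} (hd : d ∈ (minor l I).support) :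
    expWeight (fun v => c v.1) d
      = ∑ m ∈ Finset.range l, c m * ((m : ℝ) - countBelow I m) := by
  induction l generalizing d with
  | zero =>
    rw [mem_support_minor_zero.1 hd, expWeight_zero]
    simp
  | succ l ih =>
    obtain ⟨r, hr, e, he, rfl⟩ := (mem_support_minor_succ hI).1 hd
    rw [expWeight_add, ih (hr.strictMono hI) he, expWeight_stepExponent, Finset.sum_range_succ,
      add_comm]
    congr 1
    · refine Finset.sum_congr rfl fun m hm => ?_
      rw [hr.countBelow_eq hI (Finset.mem_range.1 hm).le]
    · have h1 := strictMono_le_apply hI (Fin.last l)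
      rw [Fin.val_last] at h1
      rw [countBelow_eq_castSucc_add I, if_neg (by omega), add_zero, countBelow_eq_sum]
      push_cast
      have : (l : ℝ) = ∑ _a : Fin l, (1 : ℝ) := by simp
      rw [this, ← Finset.sum_sub_distrib, Finset.mul_sum]
      refine Finset.sum_congr rfl fun a _ => ?_
      split_ifs <;> simp

/-! ### Weights of the monomials at a ray -/

/-- The 0/1 vector of the ray of `{j 0 < j 1 < ⋯}`: at level `m ≥ 1` it is the indicator of the
columns strictly between `j (m - 1)` and `j m`. The value at level `0` is irrelevant, as no variable
of that level occurs in a minor. -/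
def rayWeight (j : ℕ → ℕ) (v : ℕ × ℕ) : ℕ := if j (v.1 - 1) < v.2 ∧ v.2 < j v.1 then 1 else 0

/-- The step at level `l` weighs as much as the number of terms of `r` strictly between `j (l - 1)`
and `j l`: these are all at least `l`, so none of them belongs to a fixed element of `I`. -/
theorem expWeight_rayWeight_stepExponent {j : ℕ → ℕ} (hj : StrictMono j) {l : ℕ}
    {I : Fin (l + 1) → ℕ} {r : Fin l → ℕ} (h : IsInterlacing I r) :
    expWeight (rayWeight j) (stepExponent I r) + countBelow r (j (l - 1) + 1)
      = countBelow r (j l) := by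
  rcases Nat.eq_zero_or_pos l with rfl | hl
  · simp [expWeight_stepExponent, countBelow]
  have h1 : j (l - 1) < j l := hj (by omega)
  have h2 : l - 1 ≤ j (l - 1) := hj.le_apply
  rw [expWeight_stepExponent, countBelow_eq_sum, countBelow_eq_sum, ← Finset.sum_add_distrib]
  refine Finset.sum_congr rfl fun a _ => ?_
  have := h a
  simp only [rayWeight]
  split_ifs <;> omega

/-- The lower bound for the tropical minor at a ray, without subtraction: each monomial weighs at
least `(#{a | j a < s} - #{a | I a < s}) - #{a | j (l - 1) < I a}`, for every `s`. -/
theorem le_expWeight_rayWeight {j : ℕ → ℕ} (hj : StrictMono j) {l : ℕ} {I : Fin l → ℕ}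
    (hI : StrictMono I) {d : (ℕ × ℕ) →₀ ℕ} (hd : d ∈ (minor l I).support) (s : ℕ) :
    countBelow (fun a : Fin l => j a) s + countBelow I (j (l - 1) + 1)
      ≤ expWeight (rayWeight j) d + l + countBelow I s := by
  induction l generalizing d s with
  | zero => simp [countBelow]
  | succ l ih =>
    obtain ⟨r, hr, e, he, rfl⟩ := (mem_support_minor_succ hI).1 hd
    have ih' := fun s => ih (hr.strictMono hI) he s
    rw [expWeight_add]
    have hw := expWeight_rayWeight_stepExponent hj hr
    have hjs := countBelow_eq_castSucc_add (fun a : Fin (l + 1) => j a) s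
    simp only [Fin.val_castSucc, Fin.val_last] at hjs
    rw [hjs, Nat.add_sub_cancel]
    have h1 := hr.countBelow_le s
    have h2 := hr.countBelow_succ_le (j l)
    by_cases hs : j l < s
    · rw [if_pos hs]
      have h3 : countBelow (fun a : Fin l => j a) (j l) = l :=
        countBelow_eq_of_forall le_rfl fun a => by simp [hj.lt_iff_lt]
      have h4 := countBelow_le (fun a : Fin l => j a) s
      have h5 := countBelow_mono I (show j l + 1 ≤ s from hs)
      have := ih' (j l)
      omega
    · rw [if_neg hs]
      have := ih' s
      omega

/-- The lower bound `le_expWeight_rayWeight` is attained for some monomial and some `s`. In the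
induction, `I` without its last element is used for `r` unless this costs one unit too much; then
the largest element of `I` that is at most `j l` is moved to `j l`. -/
theorem exists_expWeight_rayWeight_le {j : ℕ → ℕ} (hj : StrictMono j) {l : ℕ} {I : Fin l → ℕ}
    (hI : StrictMono I) :
    ∃ d ∈ (minor l I).support, ∃ s, expWeight (rayWeight j) d + l + countBelow I s
      ≤ countBelow (fun a : Fin l => j a) s + countBelow I (j (l - 1) + 1) := by
  induction l with
  | zero => exact ⟨0, mem_support_minor_zero.2 rfl, 0, by simp [countBelow, expWeight_zero]⟩
  | succ l ih =>
    have hJ : ∀ s, countBelow (fun a : Fin (l + 1) => j a) s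
        = countBelow (fun a : Fin l => j a) s + if j l < s then 1 else 0 := fun s => by
      have := countBelow_eq_castSucc_add (fun a : Fin (l + 1) => j a) s
      simpa only [Fin.val_castSucc, Fin.val_last] using this
    have hjl : ∀ s, j l ≤ s → countBelow (fun a : Fin l => j a) s = l := fun s hs =>
      countBelow_eq_of_forall le_rfl fun a => by
        have : j a < j l := hj a.2
        simp only [a.2, iff_true]; omega
    have hJle := countBelow_le (fun a : Fin l => j a)
    rw [Nat.add_sub_cancel]
    set q := countBelow I (j l + 1) with hq
    have step : ∀ r, IsInterlacing I r → ∃ d ∈ (minor (l + 1) I).support, ∃ s,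
        expWeight (rayWeight j) d + l + countBelow r s
          ≤ countBelow (fun a : Fin l => j a) s + countBelow r (j l) := by
      intro r hr
      obtain ⟨e, he, s, hes⟩ := ih (hr.strictMono hI)
      refine ⟨stepExponent I r + e, (mem_support_minor_succ hI).2 ⟨r, hr, e, he, rfl⟩, s, ?_⟩
      rw [expWeight_add]
      have hw := expWeight_rayWeight_stepExponent hj hr
      omega
    -- A monomial of weight zero attains the bound at `s = j l + 1`.
    have zero : ∀ d ∈ (minor (l + 1) I).support, expWeight (rayWeight j) d = 0 →
        ∃ d ∈ (minor (l + 1) I).support, ∃ s, expWeight (rayWeight j) d + (l + 1) + countBelow I s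
          ≤ countBelow (fun a : Fin (l + 1) => j a) s + q := by
      intro d hd h0
      refine ⟨d, hd, j l + 1, ?_⟩
      rw [h0, hJ, hjl _ (by omega), if_pos (by omega)]
      omega
    have hI' := isInterlacing_castSucc hI
    obtain ⟨d, hd, s, hds⟩ := step _ hI'
    have hIs := countBelow_eq_castSucc_add I
    have hqI := hIs (j l + 1)
    have hql := countBelow_le (fun a : Fin l => I a.castSucc)
    have hqm := countBelow_mono (fun a : Fin l => I a.castSucc)
    by_cases hlast : I (Fin.last l) < j l + 1
    · rw [if_pos hlast] at hqI
      have hc : countBelow (fun a : Fin l => I a.castSucc) (j l) = l :=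
        countBelow_eq_of_forall le_rfl fun a => by
          have : I a.castSucc < I (Fin.last l) := hI (Fin.castSucc_lt_last a)
          simp only [a.2, iff_true]; omega
      have hc' := hqm (Nat.le_succ (j l))
      have hc'' := hql (j l + 1)
      simp only [Nat.succ_eq_add_one] at hc'
      by_cases hs : I (Fin.last l) < s
      · have hc : countBelow (fun a : Fin l => I a.castSucc) s = l :=
          countBelow_eq_of_forall le_rfl fun a => by
            have : I a.castSucc < I (Fin.last l) := hI (Fin.castSucc_lt_last a)
            simp only [a.2, iff_true]; omega
        have := hJle s
        exact zero d hd (by omega)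
      · refine ⟨d, hd, s, ?_⟩
        rw [hIs s, if_neg hs, hJ]
        omega
    · rw [if_neg hlast, add_zero] at hqI
      by_cases h0 : expWeight (rayWeight j) d = 0
      · exact zero d hd h0
      -- Beyond `j l` the count of `j` is constant, so `s` may be assumed to be at most `j l`.
      obtain ⟨s₁, hs₁, hds₁⟩ : ∃ s₁ ≤ j l, l + 1 + countBelow I s₁
          ≤ countBelow (fun a : Fin l => j a) s₁ + q := by
        have hm := hqm (Nat.le_succ (j l))
        simp only [Nat.succ_eq_add_one] at hm
        rcases le_total s (j l) with hs | hs
        · refine ⟨s, hs, ?_⟩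
          rw [hIs, if_neg (by omega)]
          omega
        · refine ⟨j l, le_rfl, ?_⟩
          rw [hIs, if_neg (by omega), hjl _ le_rfl]
          have := hqm hs
          have := hjl _ hs
          omega
      have hq0 : 1 ≤ q := by have := hJle s₁; omega
      have hqle : q ≤ l := by have := hql (j l + 1); omega
      obtain ⟨b, hb⟩ : ∃ b : Fin l, (b : ℕ) + 1 = q := ⟨⟨q - 1, by omega⟩, by simp; omega⟩
      have hbq : I b.castSucc < j l + 1 :=
        (lt_countBelow_iff hI b.castSucc _).1 (by rw [Fin.val_castSucc]; omega)
      have hbq' : ¬ I b.succ < j l + 1 := fun h => by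
        have := (lt_countBelow_iff hI b.succ _).2 h
        rw [Fin.val_succ] at this; omega
      -- An element below `l` could not be moved. There is too little room for that: `I` has at most
      -- `l - s₁` elements in `[s₁, l)`, and `j` has at most `s₁` elements below `s₁`.
      have hbl : l ≤ I b.castSucc := by
        by_contra hc
        have h1 := (lt_countBelow_iff hI b.castSucc l).2 (by omega)
        rw [Fin.val_castSucc] at h1
        have h2 := countBelow_le_add hI s₁ l
        have h3 := countBelow_le_add (I := fun a : Fin l => j a) (fun a b h => hj h) 0 s₁
        rw [countBelow_zero] at h3
        have h4 := hJle s₁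
        omega
      have hr : IsInterlacing I (Function.update (fun a => I a.castSucc) b (j l)) := by
        intro a
        by_cases hab : a = b
        · subst hab
          rw [Function.update_self]
          omega
        · rw [Function.update_of_ne hab]
          exact hI' a
      have hrlt : ∀ a : Fin l, a ≠ b → (Function.update (fun a : Fin l => I a.castSucc) b (j l)) a
          = I a.castSucc := fun a ha => Function.update_of_ne ha _ _
      have hrb : (Function.update (fun a : Fin l => I a.castSucc) b (j l)) b = j l :=
        Function.update_self _ _ _
      set r := Function.update (fun a : Fin l => I a.castSucc) b (j l)
      have hrq : countBelow r (j l) = b := by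
        refine countBelow_eq_of_forall b.2.le fun a => ?_
        rcases lt_trichotomy a b with hab | rfl | hab
        · have : I a.castSucc < I b.castSucc := hI (by simpa using hab)
          rw [hrlt a hab.ne]
          have : (a : ℕ) < b := hab
          omega
        · rw [hrb]; simp
        · have : I b.succ ≤ I a.castSucc := hI.monotone (by rw [Fin.le_def]; simpa using hab)
          rw [hrlt a hab.ne']
          have : (b : ℕ) < a := hab
          omega
      obtain ⟨d, hd, s, hds⟩ := step r hr
      rw [hrq] at hds
      by_cases hs : s ≤ I b.castSucc
      · refine ⟨d, hd, s, ?_⟩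
        have : countBelow I s ≤ countBelow r s := by
          have hl : I b.castSucc < I (Fin.last l) := hI (Fin.castSucc_lt_last b)
          rw [hIs, if_neg (by omega), add_zero]
          refine Finset.card_le_card fun a => ?_
          simp only [Finset.mem_filter, Finset.mem_univ, true_and]
          intro ha
          rwa [hrlt]
          rintro rfl
          omega
        rw [hJ]
        omega
      · have h1 : countBelow r (I b.castSucc + 1) ≤ countBelow r s := countBelow_mono r (by omega)
        have h2 := hr.countBelow_succ_le (I b.castSucc)
        have h3 := (lt_countBelow_iff hI b.castSucc (I b.castSucc + 1)).2 (by omega)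
        rw [Fin.val_castSucc] at h3
        have h4 := countBelow_mono r (show I b.castSucc ≤ s by omega)
        have h5 := hJle s
        exact zero d hd (by omega)

/-! ### Comparison with the positive parametrization -/

/-- The sum over chains `b_i ≤ ⋯ ≤ b_{i+m-1}` of products of variables, in recursive form: the last
factor is at level `i + m`, and its column bounds those of the earlier ones. -/
noncomputable def chainSum (i : ℕ) : ℕ → ℕ → MvPolynomial (ℕ × ℕ) ℝ
  | 0, _ => 1
  | m + 1, c => ∑ t ∈ Finset.Ico (i + m + 1) c, MvPolynomial.X (i + m + 1, t) * chainSum i m t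

theorem column_eq (l c : ℕ) (i : Fin l) :
    column l c i = if c < l then (if (i : ℕ) = c then 1 else 0)
      else (-1) ^ (l - 1 - (i : ℕ)) * chainSum i (l - 1 - i) c := by
  induction l generalizing c with
  | zero => exact i.elim0
  | succ l ih =>
    induction i using Fin.lastCases with
    | last =>
      rw [column_succ_last, Fin.val_last, Nat.add_sub_cancel, Nat.sub_self, chainSum]
      split_ifs <;> first | omega | simp
    | cast i =>
      rw [column_succ_castSucc, Fin.val_castSucc]
      by_cases hc : c < l
      · rw [if_pos hc, if_pos (by omega), ih, if_pos hc]
      · rw [if_neg hc]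
        have hi := i.2
        by_cases hc' : c < l + 1
        · obtain rfl : c = l := by omega
          rw [if_pos hc', if_neg (by omega)]
          simp
        · rw [if_neg hc']
          obtain ⟨m, hm⟩ : ∃ m, l = i + m + 1 := ⟨l - 1 - i, by omega⟩
          rw [show l + 1 - 1 - (i : ℕ) = m + 1 by omega, chainSum, pow_succ, Finset.mul_sum,
            ← Finset.sum_neg_distrib, ← hm]
          refine Finset.sum_congr rfl fun t ht => ?_
          rw [Finset.mem_Ico] at ht
          rw [ih, if_neg (by omega), show l - 1 - (i : ℕ) = m by omega]
          ring

/-- The recursion for `chainSum` splits off the last term of a weakly increasing sequence. Position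
`p` at level `q` is column `p + q`. -/
theorem chainSum_eq_sum (N i m : ℕ) (j : Fin N) :
    chainSum i m (j + i + m + 1)
      = ∑ b : Fin m → Fin N, if (∀ u v, u ≤ v → b u ≤ b v) ∧ ∀ u, b u ≤ j then
          ∏ u : Fin m, MvPolynomial.X (i + u + 1, (b u : ℕ) + i + u + 1) else 0 := by
  induction m generalizing j with
  | zero => simp [chainSum]
  | succ m ih =>
    rw [← (Fin.snocEquiv fun _ => Fin N).sum_comp, Fintype.sum_prod_type, chainSum]
    have hcond : ∀ (t : Fin N) (b : Fin m → Fin N),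
        ((∀ u v, u ≤ v → (Fin.snoc b t : Fin (m + 1) → Fin N) u
            ≤ (Fin.snoc b t : Fin (m + 1) → Fin N) v)
          ∧ ∀ u, (Fin.snoc b t : Fin (m + 1) → Fin N) u ≤ j)
        ↔ t ≤ j ∧ (∀ u v, u ≤ v → b u ≤ b v) ∧ ∀ u, b u ≤ t := by
      intro t b
      constructor
      · rintro ⟨h1, h2⟩
        refine ⟨by simpa using h2 (Fin.last m), fun u v huv => ?_, fun u => ?_⟩
        · simpa using h1 u.castSucc v.castSucc (by simpa using huv)
        · simpa using h1 u.castSucc (Fin.last m) (Fin.le_last _)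
      · rintro ⟨h1, h2, h3⟩
        refine ⟨fun u v huv => ?_, fun u => ?_⟩
        · induction v using Fin.lastCases with
          | last =>
            induction u using Fin.lastCases with
            | last => exact le_rfl
            | cast u => simpa using h3 u
          | cast v =>
            induction u using Fin.lastCases with
            | last => exact absurd huv (by simp)
            | cast u => simpa using h2 u v (by simpa using huv)
        · induction u using Fin.lastCases with
          | last => simpa using h1
          | cast u => simpa using (h3 u).trans h1
    have hterm : ∀ t : Fin N, (∑ b : Fin m → Fin N,
        if (∀ u v, u ≤ v → (Fin.snocEquiv (fun _ => Fin N)) (t, b) u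
            ≤ (Fin.snocEquiv (fun _ => Fin N)) (t, b) v)
          ∧ ∀ u, (Fin.snocEquiv (fun _ => Fin N)) (t, b) u ≤ j then
          ∏ u : Fin (m + 1), (MvPolynomial.X (i + u + 1,
            ((Fin.snocEquiv (fun _ => Fin N)) (t, b) u : ℕ) + i + u + 1) :
              MvPolynomial (ℕ × ℕ) ℝ) else 0)
        = if t ≤ j then MvPolynomial.X (i + m + 1, (t : ℕ) + i + m + 1)
            * chainSum i m (t + i + m + 1) else 0 := by
      intro t
      simp only [Fin.snocEquiv, Equiv.coe_fn_mk]
      by_cases ht : t ≤ j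
      · rw [if_pos ht, ih t, Finset.mul_sum]
        refine Finset.sum_congr rfl fun b _ => ?_
        rw [Fin.prod_univ_castSucc]
        simp only [hcond, ht, true_and, Fin.snoc_castSucc, Fin.snoc_last, Fin.val_castSucc,
          Fin.val_last]
        split_ifs
        · ring
        · simp
      · rw [if_neg ht]
        refine Finset.sum_eq_zero fun b _ => if_neg ?_
        rw [hcond]
        exact fun h => ht h.1
    rw [Finset.sum_congr rfl fun t _ => hterm t, ← Finset.sum_filter]
    refine (Finset.sum_bij (fun (t : Fin N) _ => (t : ℕ) + i + m + 1) ?_ ?_ ?_ ?_).symm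
    · intro t ht
      have : (t : ℕ) ≤ j := by simpa using ht
      rw [Finset.mem_Ico]
      omega
    · intro t _ t' _ h
      ext
      omega
    · intro t ht
      rw [Finset.mem_Ico] at ht
      have := j.2
      refine ⟨⟨t - (i + m + 1), by omega⟩, Finset.mem_filter.2 ⟨Finset.mem_univ _, ?_⟩, ?_⟩
      · change t - (i + m + 1) ≤ (j : ℕ)
        omega
      · change t - (i + m + 1) + i + m + 1 = t
        omega
    · intro t _
      rfl

/-- The position in `ℕ × ℕ` (level and column) of the variable `x_{i,s}`. -/
def relabel {k n : ℕ} (v : Var k n) : ℕ × ℕ := ((v.1 : ℕ) + 1, (v.2 : ℕ) + v.1 + 1)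

theorem relabel_injective {k n : ℕ} : Function.Injective (relabel : Var k n → ℕ × ℕ) := by
  rintro ⟨a, b⟩ ⟨c, d⟩ h
  simp only [relabel, Prod.mk.injEq] at h
  ext
  · simp only; omega
  · simp only; omega

theorem rename_ladderEntry {k n : ℕ} (i : Fin k) (j : Fin (n - k)) :
    MvPolynomial.rename relabel (ladderEntry k n i j) = column k (j + k) i := by
  have hi := i.2
  rw [column_eq, if_neg (by omega), ladderEntry, map_mul, map_pow, map_neg, map_one, map_sum]
  congr 1
  have h := chainSum_eq_sum (n - k) i (k - 1 - i) j
  rw [show (j : ℕ) + i + (k - 1 - i) + 1 = j + k by omega] at h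
  rw [h, Finset.sum_filter]
  let e : Fin (k - 1 - i) ≃ {l : Fin (k - 1) // (i : ℕ) ≤ (l : ℕ)} :=
    { toFun := fun u => ⟨⟨i + u, by omega⟩, by simp⟩
      invFun := fun l => ⟨l.1 - i, by omega⟩
      left_inv := fun u => by ext; simp
      right_inv := fun l => by have := l.2; ext; simp; omega }
  rw [← (Equiv.arrowCongr e (Equiv.refl (Fin (n - k)))).sum_comp]
  refine Finset.sum_congr rfl fun b _ => ?_
  have hb : ∀ u, (Equiv.arrowCongr e (Equiv.refl (Fin (n - k)))) b (e u) = b u := fun u => by simp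
  have he : ∀ u v, e u ≤ e v ↔ u ≤ v := fun u v => by
    change (i : ℕ) + u ≤ i + v ↔ (u : ℕ) ≤ v
    omega
  have hcond : ((∀ l l', l ≤ l' → (Equiv.arrowCongr e (Equiv.refl (Fin (n - k)))) b l
        ≤ (Equiv.arrowCongr e (Equiv.refl (Fin (n - k)))) b l')
      ∧ ∀ l, (Equiv.arrowCongr e (Equiv.refl (Fin (n - k)))) b l ≤ j)
      ↔ (∀ u v, u ≤ v → b u ≤ b v) ∧ ∀ u, b u ≤ j := by
    simp only [e.surjective.forall, hb, he]
  by_cases hc : (∀ u v, u ≤ v → b u ≤ b v) ∧ ∀ u, b u ≤ j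
  · rw [if_pos (hcond.2 hc), if_pos hc, map_prod, ← e.prod_comp]
    refine Finset.prod_congr rfl fun u _ => ?_
    rw [hb, MvPolynomial.rename_X]
    simp only [relabel, e, Equiv.coe_fn_mk]
    congr 2
    omega
  · rw [if_neg (fun h => hc (hcond.1 h)), if_neg hc]

theorem rename_paramMatrix {k n : ℕ} (i : Fin k) (c : Fin n) :
    MvPolynomial.rename relabel (paramMatrix k n i c) = column k c i := by
  unfold paramMatrix
  split_ifs with h1 h2
  · rw [column_eq, if_pos h1, if_pos h2, map_one]
  · rw [column_eq, if_pos h1, if_neg h2, map_zero]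
  · rw [rename_ladderEntry]
    simp only
    congr
    omega

theorem rename_pluckerPoly {k n : ℕ} (I : KSubset k n) :
    MvPolynomial.rename relabel (pluckerPoly I) = minor k fun a => (elt I a : ℕ) := by
  unfold pluckerPoly minor
  rw [← Matrix.det_transpose, AlgHom.map_det]
  congr 1
  ext1 a i
  simp only [AlgHom.mapMatrix_apply, Matrix.map_apply, Matrix.transpose_apply,
    Matrix.submatrix_apply, id, Matrix.of_apply]
  exact rename_paramMatrix i _

theorem elt_strictMono {k n : ℕ} (I : KSubset k n) : StrictMono fun a => (elt I a : ℕ) :=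
  fun _ _ h => (I.1.orderEmbOfFin I.2).strictMono h

theorem mem_support_minor_iff {k n : ℕ} (I : KSubset k n) {e : (ℕ × ℕ) →₀ ℕ} :
    e ∈ (minor k fun a => (elt I a : ℕ)).support ↔
      ∃ d ∈ (pluckerPoly I).support, d.mapDomain relabel = e := by
  classical
  rw [← rename_pluckerPoly, MvPolynomial.support_rename_of_injective relabel_injective,
    Finset.mem_image]

theorem expWeight_mapDomain {σ τ R : Type*} [CommSemiring R] (f : σ → τ) (y : τ → R)
    (d : σ →₀ ℕ) : expWeight y (d.mapDomain f) = expWeight (fun v => y (f v)) d := by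
  unfold expWeight
  rw [Finsupp.sum_mapDomain_index] <;> intros <;> simp [add_mul]

theorem expWeight_natCast {σ : Type*} (y : σ → ℕ) (d : σ →₀ ℕ) :
    expWeight (fun v => (y v : ℝ)) d = ((expWeight y d : ℕ) : ℝ) := by
  simp [expWeight, Finsupp.sum]

theorem tropPoly_eq_of_forall {σ : Type*} {f : MvPolynomial σ ℝ} {y : σ → ℝ} {v : ℝ}
    (h1 : ∀ d ∈ f.support, v ≤ expWeight y d) (h2 : ∃ d ∈ f.support, expWeight y d ≤ v) :
    tropPoly f y = v := by
  obtain ⟨d, hd, hdv⟩ := h2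
  rw [tropPoly, dif_pos ⟨d, hd⟩]
  exact le_antisymm ((Finset.inf'_le _ hd).trans hdv) (Finset.le_inf' _ _ h1)

theorem pluckerPoly_support_nonempty {k n : ℕ} (I : KSubset k n) :
    (pluckerPoly I).support.Nonempty := by
  obtain ⟨e, he, -⟩ := exists_expWeight_rayWeight_le (j := id) strictMono_id (elt_strictMono I)
  obtain ⟨d, hd, -⟩ := (mem_support_minor_iff I).1 he
  exact ⟨d, hd⟩

theorem countBelow_elt {k n : ℕ} (I : KSubset k n) (s : ℕ) :
    countBelow (fun a => (elt I a : ℕ)) s = (I.1.filter fun c : Fin n => (c : ℕ) < s).card := by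
  unfold countBelow
  rw [← Finset.card_map (I.1.orderEmbOfFin I.2).toEmbedding]
  congr 1
  ext c
  simp only [Finset.mem_map, Finset.mem_filter, Finset.mem_univ, true_and]
  constructor
  · rintro ⟨a, ha, rfl⟩
    exact ⟨Finset.orderEmbOfFin_mem _ _ _, ha⟩
  · rintro ⟨hc, hs⟩
    have : c ∈ Set.range (I.1.orderEmbOfFin I.2) := by
      rw [Finset.range_orderEmbOfFin]; exact hc
    obtain ⟨a, rfl⟩ := this
    exact ⟨a, hs, rfl⟩

/-- Translating level `i` of `y` by `c i`. The summand for `m = 0` vanishes, so the value that the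
truncated `m - 1` gives there does not matter. -/
theorem tropParam_add_rowConstant {k n : ℕ} (y : Fin (k - 1) → Fin (n - k) → ℝ)
    (c : Fin (k - 1) → ℝ) (I : KSubset k n) :
    tropParam (fun i s => y i s + c i) I = tropParam y I
      + ∑ m ∈ Finset.range k, (if h : m - 1 < k - 1 then c ⟨m - 1, h⟩ else 0)
        * ((m : ℝ) - (I.1.filter fun c : Fin n => (c : ℕ) < m).card) := by
  set c' : ℕ → ℝ := fun m => if h : m - 1 < k - 1 then c ⟨m - 1, h⟩ else 0 with hc'
  have hne := pluckerPoly_support_nonempty I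
  have hw : ∀ d ∈ (pluckerPoly I).support,
      expWeight (fun v : Var k n => y v.1 v.2 + c v.1) d = expWeight (fun v => y v.1 v.2) d
        + ∑ m ∈ Finset.range k, c' m
          * ((m : ℝ) - (I.1.filter fun c : Fin n => (c : ℕ) < m).card) := by
    intro d hd
    have h := expWeight_of_rowConstant c' (elt_strictMono I)
      ((mem_support_minor_iff I).2 ⟨d, hd, rfl⟩)
    simp only [countBelow_elt, expWeight_mapDomain] at h
    rw [← h]
    simp only [expWeight, Finsupp.sum, ← Finset.sum_add_distrib]
    refine Finset.sum_congr rfl fun v _ => ?_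
    simp only [relabel, hc', Nat.add_sub_cancel, v.1.2, dif_pos]
    ring
  unfold tropParam
  refine tropPoly_eq_of_forall ?_ ?_
  · intro d hd
    rw [hw d hd, tropPoly, dif_pos hne]
    exact add_le_add_left (Finset.inf'_le _ hd) _
  · obtain ⟨d, hd, hdm⟩ := Finset.exists_mem_eq_inf' hne
      (fun d => d.sum fun (v : Var k n) m => (m : ℝ) * y v.1 v.2)
    refine ⟨d, hd, ?_⟩
    rw [hw d hd, tropPoly, dif_pos hne, hdm]
    exact le_rfl

/-! ### Tropical Plücker coordinates at a ray -/

/-- The representative of `𝔱_J` in `(ℝ^{n-k})^{k-1}` by which `rayVector` is defined. -/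
def rayRep {k n : ℕ} (J : KSubset k n) (i : Fin (k - 1)) (s : Fin (n - k)) : ℝ :=
  if (elt J ⟨(i : ℕ), by omega⟩ : ℕ) ≤ (s : ℕ) + (i : ℕ) ∧
        (s : ℕ) + (i : ℕ) + 2 ≤ (elt J ⟨(i : ℕ) + 1, by omega⟩ : ℕ)
    then 1 else 0

theorem rayVector_eq {k n : ℕ} (J : KSubset k n) : rayVector J = toTropSpace (rayRep J) := rfl

/-- The number of elements of `I` among the first `s` elements of `[n]`. -/
def initialCount {n : ℕ} (I : Finset (Fin n)) (s : ℕ) : ℕ :=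
  (I.filter fun c : Fin n => (c : ℕ) < s).card

theorem initialCount_of_le {n : ℕ} (I : Finset (Fin n)) {s : ℕ} (hs : n ≤ s) :
    initialCount I s = I.card := by
  unfold initialCount
  rw [Finset.filter_true_of_mem]
  intro c _
  omega

/-- `p_I^t(𝔱_J) = max_s (#(J ∩ [s]) - #(I ∩ [s])) - #{c ∈ I | c > max J}`; the hypotheses say that
`v` is the maximum. -/
theorem tropParam_rayRep {k n : ℕ} (hk : 1 ≤ k) (J I : KSubset k n) {v : ℝ}
    (h1 : ∀ s ≤ n, (initialCount J.1 s : ℝ) - initialCount I.1 s ≤ v)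
    (h2 : ∃ s ≤ n, v ≤ (initialCount J.1 s : ℝ) - initialCount I.1 s) :
    tropParam (rayRep J) I
      = v + initialCount I.1 ((elt J ⟨k - 1, by omega⟩ : ℕ) + 1) - k := by
  -- Continue the elements of `J` to a strictly increasing sequence.
  set j : ℕ → ℕ := fun a => if h : a < k then elt J ⟨a, h⟩ else n + a with hjdef
  have hj : StrictMono j := by
    intro a b hab
    by_cases hb : b < k
    · have ha : a < k := by omega
      simp only [hjdef, dif_pos ha, dif_pos hb]
      exact elt_strictMono J (by simpa using hab)
    · by_cases ha : a < k
      · simp only [hjdef, dif_pos ha, dif_neg hb]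
        omega
      · simp only [hjdef, dif_neg ha, dif_neg hb]
        omega
  have hjk : (fun a : Fin k => j a) = fun a => (elt J a : ℕ) := by
    funext a
    simp [hjdef]
  have hjl : j (k - 1) = elt J ⟨k - 1, by omega⟩ := by
    have : k - 1 < k := by omega
    simp only [hjdef, dif_pos this]
  have hy : (fun v : Var k n => ((rayWeight j (relabel v) : ℕ) : ℝ))
      = fun v => rayRep J v.1 v.2 := by
    funext v
    have hv := v.1.2
    have e1 : j (v.1 : ℕ) = elt J ⟨v.1, by omega⟩ := by
      simp only [hjdef]; rw [dif_pos (by omega)]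
    have e2 : j ((v.1 : ℕ) + 1) = elt J ⟨v.1 + 1, by omega⟩ := by
      simp only [hjdef]; rw [dif_pos (by omega)]
    simp only [rayWeight, relabel, rayRep, Nat.add_sub_cancel, e1, e2]
    split_ifs <;> first | omega | simp
  have hw : ∀ d : Var k n →₀ ℕ, ((expWeight (rayWeight j) (d.mapDomain relabel) : ℕ) : ℝ)
      = expWeight (fun v => rayRep J v.1 v.2) d := by
    intro d
    rw [← hy, expWeight_natCast, expWeight_mapDomain]
  have hcount : ∀ (K : KSubset k n) (s : ℕ),
      countBelow (fun a => (elt K a : ℕ)) s = initialCount K.1 s := countBelow_elt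
  unfold tropParam
  refine tropPoly_eq_of_forall ?_ ?_
  · intro d hd
    obtain ⟨s, _, hs⟩ := h2
    have h := le_expWeight_rayWeight hj (elt_strictMono I)
      ((mem_support_minor_iff I).2 ⟨d, hd, rfl⟩) s
    rw [hjk, hcount, hcount, hcount, hjl] at h
    rw [← hw]
    have h' : (initialCount J.1 s : ℝ) + initialCount I.1 ((elt J ⟨k - 1, by omega⟩ : ℕ) + 1)
        ≤ (expWeight (rayWeight j) (d.mapDomain relabel) : ℕ) + k + initialCount I.1 s := by
      exact_mod_cast h
    linarith
  · obtain ⟨e, he, s, h⟩ := exists_expWeight_rayWeight_le hj (elt_strictMono I)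
    obtain ⟨d, hd, rfl⟩ := (mem_support_minor_iff I).1 he
    refine ⟨d, hd, ?_⟩
    rw [hjk, hcount, hcount, hcount, hjl] at h
    rw [← hw]
    have h' : ((expWeight (rayWeight j) (d.mapDomain relabel) : ℕ) : ℝ) + k + initialCount I.1 s
        ≤ initialCount J.1 s + initialCount I.1 ((elt J ⟨k - 1, by omega⟩ : ℕ) + 1) := by
      exact_mod_cast h
    have hv : (initialCount J.1 s : ℝ) - initialCount I.1 s ≤ v := by
      rcases le_total s n with hs | hs
      · exact h1 s hs
      · have := h1 n le_rfl
        rw [initialCount_of_le _ le_rfl, initialCount_of_le _ le_rfl] at this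
        rwa [initialCount_of_le _ hs, initialCount_of_le _ hs]
    linarith

/-! ### Cyclic order and cyclic endpoints -/

theorem val_next {n : ℕ} (c : Fin n) :
    (next c : ℕ) = if (c : ℕ) + 1 = n then 0 else (c : ℕ) + 1 := by
  have := c.2
  simp only [next]
  split_ifs with h
  · rw [h, Nat.mod_self]
  · exact Nat.mod_eq_of_lt (by omega)

theorem next_injective {n : ℕ} : Function.Injective (next : Fin n → Fin n) := by
  intro a b h
  have h' := congrArg Fin.val h
  rw [val_next, val_next] at h'
  ext
  split_ifs at h' <;> omega

theorem exists_iterate_next_eq {n : ℕ} (x c : Fin n) : ∃ m, next^[m] x = c := by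
  have h : ∀ m, ((next^[m] x : Fin n) : ℕ) = (x + m) % n := by
    intro m
    induction m with
    | zero => simp [Nat.mod_eq_of_lt x.2]
    | succ m ih =>
      rw [Function.iterate_succ_apply']
      change ((next^[m] x : Fin n) + 1 : ℕ) % n = _
      rw [ih, Nat.mod_add_mod, add_assoc]
  have hx := x.2
  refine ⟨n - x + c, Fin.ext ?_⟩
  rw [h, show (x : ℕ) + (n - x + c) = c + n by omega, Nat.add_mod_right, Nat.mod_eq_of_lt c.2]

/-- Going round from a point of `J`, an endpoint of `J` is reached before leaving `J`. -/
theorem exists_iterate_next_mem_cyclicEndpoints {n : ℕ} {J : Finset (Fin n)}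
    (hJ : J ≠ Finset.univ) {x : Fin n} (hx : x ∈ J) :
    ∃ d, next^[d] x ∈ cyclicEndpoints J ∧ ∀ i ≤ d, next^[i] x ∈ J := by
  have hex : ∃ m, next^[m] x ∉ J := by
    by_contra! h
    refine hJ (Finset.eq_univ_iff_forall.2 fun c => ?_)
    obtain ⟨m, rfl⟩ := exists_iterate_next_eq x c
    exact h m
  classical
  have hspec := Nat.find_spec hex
  have hmin : ∀ i < Nat.find hex, next^[i] x ∈ J := fun i hi => not_not.1 (Nat.find_min hex hi)
  obtain ⟨d, hd⟩ : ∃ d, Nat.find hex = d + 1 := by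
    refine Nat.exists_eq_succ_of_ne_zero fun h => ?_
    rw [h] at hspec
    exact hspec hx
  rw [hd] at hspec hmin
  refine ⟨d, Finset.mem_filter.2 ⟨hmin d (by omega), ?_⟩, fun i hi => hmin i (by omega)⟩
  rwa [← Function.iterate_succ_apply' next d x]

/-- With a single endpoint `e`, the elements of `J` are determined by their distance to `e`, and the
farthest one starts the interval. -/
theorem isCyclicInterval_of_card_cyclicEndpoints_le_one {n : ℕ} {J : Finset (Fin n)}
    (hne : J.Nonempty) (hJ : J ≠ Finset.univ) (h : (cyclicEndpoints J).card ≤ 1) :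
    IsCyclicInterval J := by
  choose! d hd hdJ using fun x (hx : x ∈ J) => exists_iterate_next_mem_cyclicEndpoints hJ hx
  obtain ⟨a, ha, hmax⟩ := J.exists_max_image d hne
  refine ⟨a, d a + 1, Finset.Subset.antisymm (fun x hx => ?_) fun x hx => ?_⟩
  · have hle := hmax x hx
    have he : next^[d x] x = next^[d a] a := Finset.card_le_one.1 h _ (hd x hx) _ (hd a ha)
    rw [show d a = d x + (d a - d x) by omega, Function.iterate_add_apply] at he
    exact Finset.mem_image.2 ⟨d a - d x, Finset.mem_range.2 (by omega),
      (next_injective.iterate _ he).symm⟩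
  · obtain ⟨i, hi, rfl⟩ := Finset.mem_image.1 hx
    exact hdJ a ha i (by simpa [Nat.lt_succ_iff] using hi)

theorem initialCount_zero {n : ℕ} (I : Finset (Fin n)) : initialCount I 0 = 0 := by
  simp [initialCount]

theorem initialCount_succ {n : ℕ} (I : Finset (Fin n)) (c : Fin n) :
    initialCount I (c + 1) = initialCount I c + if c ∈ I then 1 else 0 := by
  unfold initialCount
  have h : (I.filter fun x : Fin n => (x : ℕ) < c + 1)
      = (I.filter fun x : Fin n => (x : ℕ) < c) ∪ I.filter (fun x => x = c) := by
    ext x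
    simp only [Finset.mem_filter, Finset.mem_union, Fin.ext_iff]
    by_cases hx : x ∈ I
    · simp only [hx, true_and]; omega
    · simp [hx]
  rw [h, Finset.card_union_of_disjoint, Finset.filter_eq']
  · split_ifs <;> simp
  · rw [Finset.disjoint_left]
    intro x hx hx'
    simp only [Finset.mem_filter, Fin.ext_iff] at hx hx'
    omega

/-- Passing from `c` to its cyclic successor; when this wraps around, the count restarts. -/
theorem initialCount_next {n : ℕ} (I : Finset (Fin n)) (c : Fin n) :
    initialCount I (next c + 1) + (if (c : ℕ) + 1 = n then I.card else 0)
      = initialCount I (c + 1) + if next c ∈ I then 1 else 0 := by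
  rw [initialCount_succ, val_next]
  split_ifs with h
  all_goals first
    | rw [initialCount_zero, h, initialCount_of_le I le_rfl]; omega
    | omega

/-- The difference `#(J' ∩ {0, …, c}) - #(J ∩ {0, …, c})`. For sets of the same size it vanishes at
the last `c`, so it is a function on the cyclically ordered `[n]`. -/
def heightDiff {n : ℕ} (J J' : Finset (Fin n)) (c : Fin n) : ℤ :=
  initialCount J' (c + 1) - initialCount J (c + 1)

theorem heightDiff_next {n : ℕ} {J J' : Finset (Fin n)} (h : J.card = J'.card) (c : Fin n) :
    heightDiff J J' (next c) = heightDiff J J' c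
      + (if next c ∈ J' then 1 else 0) - (if next c ∈ J then 1 else 0) := by
  have h1 := initialCount_next J c
  have h2 := initialCount_next J' c
  unfold heightDiff
  rw [h] at h1
  split_ifs at * <;> omega

/-- If the height difference is maximal at all endpoints of `J`, then it is constant. Going
backwards through `J` from an endpoint it cannot decrease, and going forwards through the complement
of `J` it cannot decrease either. -/
theorem eq_of_cyclicEndpoints_maximal {n : ℕ} {J J' : Finset (Fin n)} (h : J.card = J'.card)
    (hne : J.Nonempty) (hJ : J ≠ Finset.univ) {A : ℤ} (hA : ∀ c, heightDiff J J' c ≤ A)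
    (hS : ∀ c ∈ cyclicEndpoints J, heightDiff J J' c = A) : J = J' := by
  have back : ∀ (d : ℕ) (c : Fin n), (∀ i ≤ d, next^[i] c ∈ J) →
      heightDiff J J' (next^[d] c) = A → heightDiff J J' c = A := by
    intro d
    induction d with
    | zero => intro c _ h; exact h
    | succ d ih =>
      intro c hc hd
      have h1 := ih (next c) (fun i hi => hc (i + 1) (by omega)) hd
      have h2 := heightDiff_next h c
      rw [h1, if_pos (show next c ∈ J from hc 1 (by omega))] at h2
      have := hA c
      split_ifs at h2 <;> omega
  have hmem : ∀ c ∈ J, heightDiff J J' c = A := by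
    intro c hc
    obtain ⟨d, hd, hdJ⟩ := exists_iterate_next_mem_cyclicEndpoints hJ hc
    exact back d c hdJ (hS _ hd)
  obtain ⟨x, hx⟩ := hne
  have hall : ∀ c, heightDiff J J' c = A := by
    intro c
    obtain ⟨m, rfl⟩ := exists_iterate_next_eq x c
    induction m with
    | zero => exact hmem x hx
    | succ m ih =>
      rw [Function.iterate_succ_apply']
      by_cases hm : next (next^[m] x) ∈ J
      · exact hmem _ hm
      · have h2 := heightDiff_next h (next^[m] x)
        rw [ih, if_neg hm] at h2
        have := hA (next (next^[m] x))
        split_ifs at h2 <;> omega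
  ext c
  obtain ⟨c, rfl⟩ := (Finite.surjective_of_injective next_injective) c
  have h2 := heightDiff_next h c
  rw [hall, hall] at h2
  split_ifs at h2 with h3 h4 h4 <;> first | omega | simp [h3, h4]

/-! ### Alternating sums over subsets -/

/-- The alternating sum of `f` over the subsets of `S`. -/
def altSum {α : Type*} (S : Finset α) (f : Finset α → ℝ) : ℝ :=
  ∑ M ∈ S.powerset, (-1) ^ M.card * f M

section
variable {α : Type*} {S : Finset α}

theorem altSum_add (f g : Finset α → ℝ) :
    altSum S (fun M => f M + g M) = altSum S f + altSum S g := by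
  simp [altSum, mul_add, Finset.sum_add_distrib]

variable [DecidableEq α]

/-- The alternating sum vanishes if `f` ignores some element of `S`. -/
theorem altSum_eq_zero {f : Finset α → ℝ} {m : α} (hm : m ∈ S)
    (h : ∀ M ⊆ S, m ∉ M → f (insert m M) = f M) : altSum S f = 0 := by
  unfold altSum
  conv_lhs => rw [← Finset.insert_erase hm]
  rw [Finset.sum_powerset_insert (Finset.notMem_erase m S), ← Finset.sum_add_distrib]
  refine Finset.sum_eq_zero fun M hM => ?_
  have hM' := Finset.mem_powerset.1 hM
  have hmM : m ∉ M := fun h => Finset.notMem_erase m S (hM' h)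
  rw [Finset.card_insert_of_notMem hmM, h M (hM'.trans (Finset.erase_subset _ _)) hmM]
  ring

/-- Each summand `g x` ignores all elements of `S` other than `x`. -/
theorem altSum_sum_eq_zero (hS : 2 ≤ S.card) (g : α → ℝ) :
    altSum S (fun M => ∑ x ∈ M, g x) = 0 := by
  have h1 : altSum S (fun M => ∑ x ∈ M, g x)
      = ∑ x ∈ S, altSum S fun M => if x ∈ M then g x else 0 := by
    unfold altSum
    rw [Finset.sum_comm]
    refine Finset.sum_congr rfl fun M hM => ?_
    rw [← Finset.mul_sum, Finset.sum_ite_mem,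
      Finset.inter_eq_right.2 (Finset.mem_powerset.1 hM)]
  rw [h1]
  refine Finset.sum_eq_zero fun x _ => ?_
  obtain ⟨m, hm, hmx⟩ := Finset.exists_mem_ne hS x
  exact altSum_eq_zero hm fun M _ _ => by simp [Finset.mem_insert, hmx.symm]

theorem altSum_hits (hS : S.Nonempty) (T : Finset α) :
    altSum S (fun M => if Disjoint M T then 0 else 1) = if S ⊆ T then -1 else 0 := by
  by_cases hST : S ⊆ T
  · rw [if_pos hST]
    -- On subsets of `T`, adding the indicator of `∅` gives the constant `1`.
    have h1 : altSum S (fun M => (if Disjoint M T then 0 else 1) + if M = ∅ then 1 else 0) = 0 := by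
      obtain ⟨m, hm⟩ := hS
      refine altSum_eq_zero hm fun M hM _ => ?_
      rcases M.eq_empty_or_nonempty with rfl | hne
      · simp [hST hm]
      · have h2 : ¬ Disjoint M T := fun h => by
          obtain ⟨x, hx⟩ := hne
          exact Finset.disjoint_left.1 h hx (hST (hM hx))
        simp [hne.ne_empty, h2]
    have h2 : altSum S (fun M => if M = ∅ then 1 else 0) = 1 := by
      simp [altSum]
    rw [altSum_add, h2] at h1
    linarith
  · rw [if_neg hST]
    obtain ⟨m, hm, hmT⟩ := Finset.not_subset.1 hST
    exact altSum_eq_zero hm fun M _ _ => by simp [hmT]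

end

/-! ### Planar cross-ratios -/

/-- The set obtained from `J` by moving the elements of `M` one step to the right. -/
def moveRight {n : ℕ} (J M : Finset (Fin n)) : Finset (Fin n) := (J \ M) ∪ M.image next

section
variable {n : ℕ} {J M : Finset (Fin n)}

theorem next_notMem_of_subset (hM : M ⊆ cyclicEndpoints J) {x : Fin n} (hx : x ∈ M) :
    next x ∉ J := (Finset.mem_filter.1 (hM hx)).2

theorem subset_of_subset_cyclicEndpoints (hM : M ⊆ cyclicEndpoints J) : M ⊆ J :=
  hM.trans (Finset.filter_subset _ _)

theorem sum_moveRight {R : Type*} [AddCommGroup R] (hM : M ⊆ cyclicEndpoints J) (w : Fin n → R) :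
    ∑ c ∈ moveRight J M, w c = ∑ c ∈ J, w c + ∑ x ∈ M, (w (next x) - w x) := by
  have hdisj : Disjoint (J \ M) (M.image next) := by
    rw [Finset.disjoint_right]
    intro c hc hc'
    obtain ⟨x, hx, rfl⟩ := Finset.mem_image.1 hc
    exact next_notMem_of_subset hM hx (Finset.mem_sdiff.1 hc').1
  rw [moveRight, Finset.sum_union hdisj, Finset.sum_image next_injective.injOn,
    Finset.sum_sub_distrib, ← Finset.sum_sdiff (subset_of_subset_cyclicEndpoints hM)]
  abel

theorem card_moveRight (hM : M ⊆ cyclicEndpoints J) : (moveRight J M).card = J.card := by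
  have h := sum_moveRight hM (fun _ => (1 : ℤ))
  simpa using h

theorem inter_moveRight (hM : M ⊆ cyclicEndpoints J) : J ∩ moveRight J M = J \ M := by
  ext c
  simp only [moveRight, Finset.mem_inter, Finset.mem_union, Finset.mem_sdiff, Finset.mem_image]
  constructor
  · rintro ⟨hc, h | ⟨x, hx, rfl⟩⟩
    · exact h
    · exact absurd hc (next_notMem_of_subset hM hx)
  · intro h
    exact ⟨h.1, Or.inl h⟩

theorem initialCount_eq_sum (I : Finset (Fin n)) (s : ℕ) :
    (initialCount I s : ℝ) = ∑ c ∈ I, if (c : ℕ) < s then 1 else 0 := by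
  rw [initialCount, Finset.card_filter]
  push_cast
  rfl

theorem initialCount_moveRight (hM : M ⊆ cyclicEndpoints J) (s : ℕ) :
    (initialCount (moveRight J M) s : ℝ) = initialCount J s
      + ∑ x ∈ M, ((if (next x : ℕ) < s then 1 else 0) - if (x : ℕ) < s then 1 else 0) := by
  rw [initialCount_eq_sum, initialCount_eq_sum, sum_moveRight hM]

/-- Of the elements moved, only `c` leaves `{0, …, c}`, unless it is the last element of `[n]`,
which moves to `0` and thus is in `{0, …, c}` afterwards for every `c`. -/
theorem initialCount_moveRight_succ (hM : M ⊆ cyclicEndpoints J) (c : Fin n) :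
    (initialCount (moveRight J M) (c + 1) : ℝ) = initialCount J (c + 1)
      - (if c ∈ M then 1 else 0) + ∑ x ∈ M, if (x : ℕ) + 1 = n then 1 else 0 := by
  rw [initialCount_moveRight hM]
  have h : (if c ∈ M then (1 : ℝ) else 0) = ∑ x ∈ M, if x = c then 1 else 0 := by
    simp
  rw [h, sub_add, ← Finset.sum_sub_distrib, sub_eq_add_neg, ← Finset.sum_neg_distrib]
  congr 1
  refine Finset.sum_congr rfl fun x _ => ?_
  have hx := x.2
  have hc := c.2
  simp only [val_next, Fin.ext_iff]
  split_ifs <;> first | omega | norm_num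

end

/-- The elements of the cubical array correspond to the subsets `M` of the endpoints, and the sign
`(-1) ^ (#(J ∩ K) - k - 1)` is `-(-1) ^ #M` as `#(J ∩ K) = k - #M`. -/
theorem tropCrossRatio_eq_altSum {k n : ℕ} (J : KSubset k n) (π : KSubset k n → ℝ)
    (f : Finset (Fin n) → ℝ)
    (hf : ∀ M ⊆ cyclicEndpoints J.1, ∀ K : KSubset k n, K.1 = moveRight J.1 M → π K = f M) :
    tropCrossRatio J π = -altSum (cyclicEndpoints J.1) f := by
  unfold tropCrossRatio altSum
  rw [← Finset.sum_neg_distrib]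
  symm
  refine Finset.sum_bij (fun M hM => (⟨moveRight J.1 M,
    (card_moveRight (Finset.mem_powerset.1 hM)).trans J.2⟩ : KSubset k n)) ?_ ?_ ?_ ?_
  · intro M hM
    exact Finset.mem_filter.2 ⟨Finset.mem_univ _, M, hM, rfl⟩
  · intro M hM M' hM' h
    rw [Finset.mem_powerset] at hM hM'
    have h' : moveRight J.1 M = moveRight J.1 M' := congrArg Subtype.val h
    have h2 : J.1 \ M = J.1 \ M' := by rw [← inter_moveRight hM, h', inter_moveRight hM']
    rw [← Finset.sdiff_sdiff_eq_self (subset_of_subset_cyclicEndpoints hM), h2,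
      Finset.sdiff_sdiff_eq_self (subset_of_subset_cyclicEndpoints hM')]
  · intro K hK
    obtain ⟨M, hM, h⟩ := (Finset.mem_filter.1 hK).2
    exact ⟨M, hM, Subtype.ext h.symm⟩
  · intro M hM
    rw [Finset.mem_powerset] at hM
    have hMJ := subset_of_subset_cyclicEndpoints hM
    rw [hf M hM _ rfl]
    simp only [inter_moveRight hM]
    have hcard : (J.1 \ M).card + M.card = k := by
      rw [Finset.card_sdiff_add_card_eq_card hMJ, J.2]
    have hz : (((J.1 \ M).card : ℤ) - (k : ℤ) - 1) = -((M.card + 1 : ℕ) : ℤ) := by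
      push_cast; omega
    rw [hz, zpow_neg, zpow_natCast, ← inv_pow, inv_neg, inv_one, pow_succ]
    ring

theorem tropCrossRatio_initialCount {k n : ℕ} {J : KSubset k n}
    (hS : 2 ≤ (cyclicEndpoints J.1).card) (κ : ℝ) (s : ℕ) :
    tropCrossRatio J (fun I => κ - initialCount I.1 s) = 0 := by
  rw [tropCrossRatio_eq_altSum J _ (fun M => (κ - initialCount J.1 s) + ∑ x ∈ M,
    -((if (next x : ℕ) < s then 1 else 0) - if (x : ℕ) < s then 1 else 0)), altSum_add,
    altSum_sum_eq_zero hS, add_zero, neg_eq_zero]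
  · obtain ⟨m, hm⟩ := Finset.card_pos.1 (show 0 < (cyclicEndpoints J.1).card by omega)
    exact altSum_eq_zero hm fun _ _ _ => rfl
  · intro M hM K hK
    rw [hK, initialCount_moveRight hM, Finset.sum_neg_distrib]
    ring

theorem tropCrossRatio_add {k n : ℕ} (J : KSubset k n) (π ρ : KSubset k n → ℝ) :
    tropCrossRatio J (fun I => π I + ρ I) = tropCrossRatio J π + tropCrossRatio J ρ := by
  simp [tropCrossRatio, mul_add, Finset.sum_add_distrib]

theorem tropCrossRatio_sum_mul {k n : ℕ} (J : KSubset k n) {ι : Type*} (s : Finset ι) (c : ι → ℝ)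
    (π : ι → KSubset k n → ℝ) :
    tropCrossRatio J (fun I => ∑ i ∈ s, c i * π i I) = ∑ i ∈ s, c i * tropCrossRatio J (π i) := by
  simp only [tropCrossRatio, Finset.mul_sum]
  rw [Finset.sum_comm]
  exact Finset.sum_congr rfl fun _ _ => Finset.sum_congr rfl fun _ _ => by ring

theorem tropCrossRatio_add_rowConstant {k n : ℕ} {J : KSubset k n}
    (hS : 2 ≤ (cyclicEndpoints J.1).card) (y : Fin (k - 1) → Fin (n - k) → ℝ)
    (c : Fin (k - 1) → ℝ) :
    tropCrossRatio J (tropParam fun i s => y i s + c i) = tropCrossRatio J (tropParam y) := by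
  have h := funext (tropParam_add_rowConstant y c)
  rw [h, tropCrossRatio_add, tropCrossRatio_sum_mul, add_eq_left]
  refine Finset.sum_eq_zero fun m _ => ?_
  exact mul_eq_zero_of_right _ (tropCrossRatio_initialCount hS _ _)

/-- The maximum in `tropParam_rayRep` increases by one when `M` meets the set of maximizers of the
height difference, apart from a correction that is additive in `M`. -/
theorem tropParam_rayRep_moveRight {k n : ℕ} (hk : 1 ≤ k) (J J' : KSubset k n) {A : ℤ}
    (hA : ∀ c, heightDiff J.1 J'.1 c ≤ A) (hA' : ∃ c, heightDiff J.1 J'.1 c = A)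
    {M : Finset (Fin n)} (hM : M ⊆ cyclicEndpoints J.1) (K : KSubset k n)
    (hK : K.1 = moveRight J.1 M) :
    tropParam (rayRep J') K
      = (A + (if Disjoint M (Finset.univ.filter fun c => heightDiff J.1 J'.1 c = A) then 0 else 1)
          - ∑ x ∈ M, if (x : ℕ) + 1 = n then 1 else 0)
        + initialCount K.1 ((elt J' ⟨k - 1, by omega⟩ : ℕ) + 1) - k := by
  have hval : ∀ c : Fin n, (initialCount J'.1 (c + 1) : ℝ) - initialCount K.1 (c + 1)
      = heightDiff J.1 J'.1 c + (if c ∈ M then 1 else 0)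
        - ∑ x ∈ M, if (x : ℕ) + 1 = n then 1 else 0 := by
    intro c
    rw [hK, initialCount_moveRight_succ hM, heightDiff]
    push_cast
    ring
  have hpos : ∀ c : Fin n, (initialCount J'.1 (c + 1) : ℝ) - initialCount K.1 (c + 1)
      ≤ A + (if Disjoint M (Finset.univ.filter fun c => heightDiff J.1 J'.1 c = A) then 0 else 1)
          - ∑ x ∈ M, if (x : ℕ) + 1 = n then 1 else 0 := by
    intro c
    rw [hval]
    refine sub_le_sub_right ?_ _
    have h0 : (heightDiff J.1 J'.1 c : ℝ) ≤ A := by exact_mod_cast hA c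
    by_cases hc : c ∈ M
    · by_cases hd : Disjoint M (Finset.univ.filter fun c => heightDiff J.1 J'.1 c = A)
      · have h1 : heightDiff J.1 J'.1 c ≠ A := fun h =>
          Finset.disjoint_left.1 hd hc (by simpa using h)
        have h2 : heightDiff J.1 J'.1 c + 1 ≤ A := by have := hA c; omega
        rw [if_pos hc, if_pos hd, add_zero]
        exact_mod_cast h2
      · rw [if_pos hc, if_neg hd]
        linarith
    · rw [if_neg hc]
      split_ifs <;> linarith
  have hn : 0 < n := by obtain ⟨c, -⟩ := hA'; exact c.pos
  refine tropParam_rayRep hk J' K (fun s hs => ?_) ?_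
  · rcases Nat.eq_zero_or_pos s with rfl | h0
    · have := hpos ⟨n - 1, by omega⟩
      simp only [Nat.sub_add_cancel hn] at this
      rw [initialCount_of_le _ le_rfl, initialCount_of_le _ le_rfl, J'.2, K.2, sub_self] at this
      simpa [initialCount_zero] using this
    · have := hpos ⟨s - 1, by omega⟩
      simpa only [Nat.sub_add_cancel h0] using this
  · by_cases hd : Disjoint M (Finset.univ.filter fun c => heightDiff J.1 J'.1 c = A)
    · obtain ⟨c, hc⟩ := hA'
      refine ⟨c + 1, c.2, ?_⟩
      have hcM : c ∉ M := fun h => Finset.disjoint_left.1 hd h (by simpa using hc)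
      rw [hval, if_pos hd, if_neg hcM, hc]
    · obtain ⟨c, hcM, hc⟩ := Finset.not_disjoint_iff.1 hd
      refine ⟨c + 1, c.2, ?_⟩
      rw [hval, if_neg hd, if_pos hcM, (Finset.mem_filter.1 hc).2]

theorem tropCrossRatio_rayRep {k n : ℕ} (hk : 1 ≤ k) (hkn : k < n) {J : KSubset k n}
    (hS : 2 ≤ (cyclicEndpoints J.1).card) (J' : KSubset k n) :
    tropCrossRatio J (tropParam (rayRep J')) = if J = J' then 1 else 0 := by
  have hne : J.1.Nonempty := Finset.card_pos.1 (by rw [J.2]; omega)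
  have huniv : J.1 ≠ Finset.univ := fun h => by
    have := J.2
    rw [h, Finset.card_univ, Fintype.card_fin] at this
    omega
  have hSne : (cyclicEndpoints J.1).Nonempty := Finset.card_pos.1 (by omega)
  obtain ⟨c₀, -, hc₀⟩ := Finset.exists_max_image Finset.univ (heightDiff J.1 J'.1)
    ⟨⟨0, by omega⟩, Finset.mem_univ _⟩
  obtain ⟨A, hAdef⟩ : ∃ A, heightDiff J.1 J'.1 c₀ = A := ⟨_, rfl⟩
  have hA : ∀ c, heightDiff J.1 J'.1 c ≤ A := fun c => hAdef ▸ hc₀ c (Finset.mem_univ _)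
  set T : Finset (Fin n) := Finset.univ.filter fun c => heightDiff J.1 J'.1 c = A with hT
  set s : ℕ := (elt J' ⟨k - 1, by omega⟩ : ℕ) + 1
  rw [tropCrossRatio_eq_altSum J _ (fun M => (if Disjoint M T then 0 else 1)
    + ((A + initialCount J.1 s - k) + ∑ x ∈ M, (((if (next x : ℕ) < s then 1 else 0)
      - if (x : ℕ) < s then 1 else 0) - if (x : ℕ) + 1 = n then 1 else 0))),
    altSum_add, altSum_add, altSum_sum_eq_zero hS, altSum_hits hSne]
  · obtain ⟨m, hm⟩ := hSne
    rw [altSum_eq_zero hm fun _ _ _ => rfl]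
    have hiff : cyclicEndpoints J.1 ⊆ T ↔ J = J' := by
      constructor
      · intro h
        refine Subtype.ext (eq_of_cyclicEndpoints_maximal (J.2.trans J'.2.symm) hne huniv hA ?_)
        intro c hc
        exact (Finset.mem_filter.1 (h hc)).2
      · rintro rfl c -
        rw [hT, Finset.mem_filter, ← hAdef]
        simp [heightDiff]
    simp only [hiff]
    split_ifs <;> norm_num
  · intro M hM K hK
    rw [tropParam_rayRep_moveRight hk J J' hA ⟨c₀, hAdef⟩ hM K hK, hK, initialCount_moveRight hM,
      Finset.sum_sub_distrib _ (fun x : Fin n => if (x : ℕ) + 1 = n then (1 : ℝ) else 0)]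
    ring

end PlanarCrossRatio

/-- For non-cyclic `J`, the tropical planar cross-ratio `u_J^t`, pulled back along the tropical
positive parametrization, descends to a function `u` on `𝕋^{k,n}`, and this function takes the
value `δ_{J,J'}` at `𝔱_{J'}` for all non-cyclic `J'`. -/
theorem theorem2p9 (k n : ℕ) (hk : 2 ≤ k) (hn : k + 2 ≤ n)
    (J : PlanarCrossRatio.KSubset k n) (hJ : ¬ PlanarCrossRatio.IsCyclicInterval J.1) :
    ∃ u : PlanarCrossRatio.TropSpace k n → ℝ,
      (∀ y : Fin (k - 1) → Fin (n - k) → ℝ,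
        u (PlanarCrossRatio.toTropSpace y)
          = PlanarCrossRatio.tropCrossRatio J (PlanarCrossRatio.tropParam y)) ∧
      ∀ J' : PlanarCrossRatio.KSubset k n, ¬ PlanarCrossRatio.IsCyclicInterval J'.1 →
        u (PlanarCrossRatio.rayVector J') = if J = J' then 1 else 0 := by
  have hS : 2 ≤ (PlanarCrossRatio.cyclicEndpoints J.1).card := by
    by_contra h
    refine hJ (PlanarCrossRatio.isCyclicInterval_of_card_cyclicEndpoints_le_one
      (Finset.card_pos.1 (by rw [J.2]; omega)) (fun h => ?_) (by omega))
    have := J.2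
    rw [h, Finset.card_univ, Fintype.card_fin] at this
    omega
  have hdesc : ∀ y : Fin (k - 1) → Fin (n - k) → ℝ,
      PlanarCrossRatio.tropCrossRatio J (PlanarCrossRatio.tropParam fun i =>
        Function.surjInv (Submodule.mkQ_surjective _) (PlanarCrossRatio.toTropSpace y i))
        = PlanarCrossRatio.tropCrossRatio J (PlanarCrossRatio.tropParam y) := by
    intro y
    have h : ∀ i, ∃ c : ℝ, ∀ s,
        Function.surjInv (Submodule.mkQ_surjective _) (PlanarCrossRatio.toTropSpace y i) s
          = y i s + c := by
      intro i
      have h1 := Function.surjInv_eq (Submodule.mkQ_surjective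
        (Submodule.span ℝ {(fun _ => 1 : Fin (n - k) → ℝ)})) (PlanarCrossRatio.toTropSpace y i)
      have h2 := (Submodule.Quotient.eq _).1 h1
      obtain ⟨c, hc⟩ := Submodule.mem_span_singleton.1 h2
      refine ⟨c, fun s => ?_⟩
      have := congrFun hc s
      simp only [Pi.smul_apply, smul_eq_mul, mul_one, Pi.sub_apply] at this
      linarith
    choose c hc using h
    rw [← PlanarCrossRatio.tropCrossRatio_add_rowConstant hS y c]
    congr 2
    funext i s
    exact hc i s
  refine ⟨fun q => PlanarCrossRatio.tropCrossRatio J (PlanarCrossRatio.tropParam fun i =>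
    Function.surjInv (Submodule.mkQ_surjective _) (q i)), hdesc, fun J' _ => ?_⟩
  rw [PlanarCrossRatio.rayVector_eq]
  exact (hdesc _).trans (PlanarCrossRatio.tropCrossRatio_rayRep (by omega) (by omega) hS J')
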